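/- **Setting.** An initial data set $(M,g,k)$ is a three-dimensional manifold $M$ with a Riemannian metric $g$ (of class $C^2$) and a symmetric $(0,2)$-tensor $k$ (of class $C^1$). Its mass density is $\mu=\tfrac12\big(R_g-|k|_g^2+(\mathrm{tr}_g k)^2\big)$, its current density is $J=\mathrm{div}_g k-d(\mathrm{tr}_g k)$, and its conjugate momentum is $\pi=k-(\mathrm{tr}_g k)\,g$. For a function $f$ defined near infinity in $\mathbb R^3$ and $r=|x|$, $f=O_n(r^{a})$ (respectively $o_n(r^a)$) means that $f$ is $C^n$ near infinity and that its derivatives of each order $m\le n$ are $O(r^{a-m})$ (respectively $o(r^{a-m})$). $(M,g,k)$ is *asymptotically flat* if there are constants $q>\frac12$, $p_0>\frac32$, $\epsilon_0>0$ and a compact set $K\subset M$ such that $M\setminus K$ has finitely many connected components (ends), each with a smooth diffeomorphism onto the complement of a compact set in $\mathbb R^3$, in whose Cartesian coordinates $$g_{ij}-\delta_{ij}=O_2(r^{-q}),\qquad k_{ij}=O_1(r^{-p_0}),\qquad \mu=O(r^{-3-\epsilon_0}),\qquad |J|_g=O(r^{-3-\epsilon_0}).$$ **Theorem.** Let $(M,g,k)$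 be an asymptotically flat initial data set, and fix one of its ends with its asymptotically flat coordinates. Suppose that on this end $$\pi_{ij}(x)=\bar\pi_{ij}\big(\tfrac{x}{|x|}\big)\,r^{-p}+\pi^{(-3)}_{ij}\big(\tfrac{x}{|x|}\big)\,r^{-3}+o_1(r^{-3}),\qquad \tfrac32<p<3,$$ where $\bar\pi$ and $\pi^{(-3)}$ are $C^1$ fields of $(0,2)$-tensors on $\mathbb R^3$ along the unit sphere $S^2$ (independent of $r$), and that $|J|_g=O(r^{-4-\epsilon})$ on this end for some $\epsilon>0$. Then the ADM angular momentum of the end is finite: for each rotation field $Y=\frac{\partial}{\partial x^i}\times\vec x$, $i=1,2,3$, the limit $$J(Y)=\frac1{8\pi}\lim_{r\to\infty}\int_{|x|=r}\sum_{j,k}\pi_{jk}\,Y^j\,\frac{x^k}{|x|}\,d\sigma_0$$ exists as a real number, where $d\sigma_0$ is the standard area measure of the sphere of radius $r$ (the integrand being integrable for all large $r$; in the prefactor $\frac{1}{8\pi}$, $\pi$ denotes the number). Moreover $$J(Y)=\frac1{8\pi}\int_{S^2}\sum_{j,k}\pi^{(-3)}_{jk}\,Y^j\,\tilde x^k\,d\mu_{S^2}=\frac1{8\pi}\int_{S^2}\tilde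 x^i\,(*d\alpha)\,d\mu_{S^2},$$ where $\tilde x^1,\tilde x^2,\tilde x^3$ are the coordinate functions on $S^2$, $d\mu_{S^2}$ is the standard measure, $\alpha$ is the one-form $\alpha(v)=\sum_{j,k}\pi^{(-3)}_{jk}v^j\tilde x^k$ on $S^2$, and $*$ is the Hodge star of $S^2$ with the orientation given by the outer normal. -/

import Mathlib

open Set Filter Topology MeasureTheory
open scoped Manifold ContDiff Matrix

noncomputable section

/-- Euclidean three-space. -/
abbrev E3 : Type := EuclideanSpace ℝ (Fin 3)

/-- The `i`-th standard basis vector of `E3`. -/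
def basisVec (i : Fin 3) : E3 := EuclideanSpace.single i 1

/-! ### Decay at infinity -/

/-- `f = O_n(r^a)`: `f` is `C^n` near infinity and, for every `m ≤ n`, its derivatives of order `m`
are `O(r^(a - m))` as `r = ‖x‖ → ∞`. -/
def IsBigOOrder (n : ℕ) (f : E3 → ℝ) (a : ℝ) : Prop :=
  (∃ R : ℝ, ContDiffOn ℝ n f {x | R < ‖x‖}) ∧
    ∀ m : ℕ, m ≤ n →
      (fun x => iteratedFDeriv ℝ m f x) =O[Bornology.cobounded E3] fun x => ‖x‖ ^ (a - m)

/-- `f = o_n(r^a)`: `f` is `C^n` near infinity and, for every `m ≤ n`, its derivatives of order `m`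
are `o(r^(a - m))` as `r = ‖x‖ → ∞`. -/
def IsLittleOOrder (n : ℕ) (f : E3 → ℝ) (a : ℝ) : Prop :=
  (∃ R : ℝ, ContDiffOn ℝ n f {x | R < ‖x‖}) ∧
    ∀ m : ℕ, m ≤ n →
      (fun x => iteratedFDeriv ℝ m f x) =o[Bornology.cobounded E3] fun x => ‖x‖ ^ (a - m)

/-! ### Tensor calculus in coordinates

A field of bilinear forms on (a region of) `E3` is given by its matrix of Cartesian components. -/

/-- Cartesian components of a field of bilinear forms on `E3`. -/
abbrev TensorField : Type := E3 → Matrix (Fin 3) (Fin 3) ℝ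

/-- The partial derivative `∂ᵢ f`. -/
def partialD (i : Fin 3) (f : E3 → ℝ) (x : E3) : ℝ := fderiv ℝ f x (basisVec i)

/-- The Christoffel symbol `Γᵏᵢⱼ = ½ gᵏˡ (∂ᵢ gⱼₗ + ∂ⱼ gᵢₗ - ∂ₗ gᵢⱼ)`. -/
def christoffel (g : TensorField) (k i j : Fin 3) (x : E3) : ℝ :=
  (1 / 2) * ∑ l, (g x)⁻¹ k l *
    (partialD i (fun y => g y j l) x + partialD j (fun y => g y i l) x
      - partialD l (fun y => g y i j) x)

/-- The Ricci tensor `Rᵢⱼ = ∂ₖ Γᵏᵢⱼ - ∂ⱼ Γᵏᵢₖ + Γᵏₖₗ Γˡᵢⱼ - Γᵏⱼₗ Γˡᵢₖ`. -/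
def ricci (g : TensorField) (i j : Fin 3) (x : E3) : ℝ :=
  ∑ k, (partialD k (christoffel g k i j) x - partialD j (christoffel g k i k) x
    + ∑ l, (christoffel g k k l x * christoffel g l i j x
        - christoffel g k j l x * christoffel g l i k x))

/-- The scalar curvature `R_g = gⁱʲ Rᵢⱼ`. -/
def scalarCurvature (g : TensorField) (x : E3) : ℝ :=
  ∑ i, ∑ j, (g x)⁻¹ i j * ricci g i j x

/-- The trace `tr_g k = gⁱʲ kᵢⱼ`. -/
def traceWrt (g k : TensorField) (x : E3) : ℝ :=
  ∑ i, ∑ j, (g x)⁻¹ i j * k x i j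

/-- The squared length `|k|_g² = gⁱᵃ gʲᵇ kᵢⱼ kₐᵦ`. -/
def sqLength (g k : TensorField) (x : E3) : ℝ :=
  ∑ i, ∑ j, ∑ a, ∑ b, (g x)⁻¹ i a * (g x)⁻¹ j b * k x i j * k x a b

/-- The covariant derivative `∇ₗ kᵢⱼ = ∂ₗ kᵢⱼ - Γᵐₗᵢ kₘⱼ - Γᵐₗⱼ kᵢₘ`. -/
def covDeriv (g k : TensorField) (l i j : Fin 3) (x : E3) : ℝ :=
  partialD l (fun y => k y i j) x
    - ∑ m, (christoffel g m l i x * k x m j + christoffel g m l j x * k x i m)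

/-- The divergence `(div_g k)ⱼ = gˡⁱ ∇ₗ kᵢⱼ`. -/
def divergenceWrt (g k : TensorField) (j : Fin 3) (x : E3) : ℝ :=
  ∑ l, ∑ i, (g x)⁻¹ l i * covDeriv g k l i j x

/-- The mass density `μ = ½ (R_g - |k|_g² + (tr_g k)²)`. -/
def massDensity (g k : TensorField) (x : E3) : ℝ :=
  (1 / 2) * (scalarCurvature g x - sqLength g k x + (traceWrt g k x) ^ 2)

/-- The current density `J = div_g k - d (tr_g k)`. -/
def currentDensity (g k : TensorField) (j : Fin 3) (x : E3) : ℝ :=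
  divergenceWrt g k j x - partialD j (traceWrt g k) x

/-- The length `|J|_g` of the current density. -/
def currentLength (g k : TensorField) (x : E3) : ℝ :=
  √(∑ i, ∑ j, (g x)⁻¹ i j * currentDensity g k i x * currentDensity g k j x)

/-- The conjugate momentum `π = k - (tr_g k) g`. -/
def conjugateMomentum (g k : TensorField) : TensorField :=
  fun x => k x - traceWrt g k x • g x

/-! ### Initial data sets -/

/-- An initial data set on a three-dimensional manifold `M`: a Riemannian metric `g` of class `C^2`
and a symmetric `(0,2)`-tensor field `k` of class `C^1`. -/
structure InitialDataSet (M : Type*) [TopologicalSpace M] [ChartedSpace E3 M]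
    [IsManifold (𝓡 3) ∞ M] where
  /-- the Riemannian metric -/
  g : Bundle.ContMDiffRiemannianMetric (𝓡 3) 2 E3 (fun x : M => TangentSpace (𝓡 3) x)
  /-- the symmetric `(0,2)`-tensor field -/
  k : ∀ x : M, TangentSpace (𝓡 3) x →L[ℝ] TangentSpace (𝓡 3) x →L[ℝ] ℝ
  k_symm : ∀ (x : M) (v w : TangentSpace (𝓡 3) x), k x v w = k x w v
  k_contMDiff : ContMDiff (𝓡 3) ((𝓡 3).prod 𝓘(ℝ, E3 →L[ℝ] E3 →L[ℝ] ℝ)) 1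
    (fun x => Bundle.TotalSpace.mk' (E3 →L[ℝ] E3 →L[ℝ] ℝ)
      (E := fun x : M => TangentSpace (𝓡 3) x →L[ℝ] TangentSpace (𝓡 3) x →L[ℝ] ℝ) x (k x))

section Manifold

variable {M : Type*} [TopologicalSpace M] [ChartedSpace E3 M] [IsManifold (𝓡 3) ∞ M]

/-- The Cartesian components `b(∂ᵢ, ∂ⱼ)`, at points of `E3`, of a `(0,2)`-tensor field `b` on `M`
in the coordinates `φ`, that is, of the pullback of `b` under `φ⁻¹`. -/
def coordComponents (φ : OpenPartialHomeomorph M E3)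
    (b : ∀ x : M, TangentSpace (𝓡 3) x →L[ℝ] TangentSpace (𝓡 3) x →L[ℝ] ℝ) : TensorField :=
  fun x => Matrix.of fun i j =>
    b (φ.symm x) (mfderiv (𝓡 3) (𝓡 3) φ.symm x (basisVec i))
      (mfderiv (𝓡 3) (𝓡 3) φ.symm x (basisVec j))

namespace InitialDataSet

/-- The components of the metric in the coordinates `φ`. -/
def gCoord (D : InitialDataSet M) (φ : OpenPartialHomeomorph M E3) : TensorField :=
  coordComponents φ D.g.inner

/-- The components of `k` in the coordinates `φ`. -/
def kCoord (D : InitialDataSet M) (φ : OpenPartialHomeomorph M E3) : TensorField :=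
  coordComponents φ D.k

/-- The components of the conjugate momentum `π = k - (tr_g k) g` in the coordinates `φ`. -/
def momentumCoord (D : InitialDataSet M) (φ : OpenPartialHomeomorph M E3) : TensorField :=
  conjugateMomentum (D.gCoord φ) (D.kCoord φ)

/-- An asymptotically flat structure on an initial data set: the complement of a compact set `K`
is the union of finitely many connected components (ends), each carrying a smooth diffeomorphism
onto the complement of a compact set in `E3` in which the data have the required decay. -/
structure AsymptoticallyFlat (D : InitialDataSet M) where
  /-- the compact set outside of which the ends lie -/
  K : Set M
  isCompact_K : IsCompact K
  /-- the number of ends -/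
  numEnds : ℕ
  /-- the asymptotically flat coordinates of each end -/
  coord : Fin numEnds → OpenPartialHomeomorph M E3
  iUnion_source : ⋃ e, (coord e).source = Kᶜ
  disjoint_source : Pairwise fun e e' => Disjoint (coord e).source (coord e').source
  isConnected_source : ∀ e, IsConnected (coord e).source
  isCompact_compl_target : ∀ e, IsCompact ((coord e).target)ᶜ
  contMDiffOn_coord : ∀ e, ContMDiffOn (𝓡 3) (𝓡 3) ∞ (coord e) (coord e).source
  contMDiffOn_coord_symm : ∀ e, ContMDiffOn (𝓡 3) (𝓡 3) ∞ (coord e).symm (coord e).target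
  /-- decay rate of the metric -/
  q : ℝ
  /-- decay rate of `k` -/
  p : ℝ
  /-- additional decay rate of the densities -/
  ε : ℝ
  q_gt : 1 / 2 < q
  p_gt : 3 / 2 < p
  ε_pos : 0 < ε
  g_decay : ∀ e i j, IsBigOOrder 2
    (fun x => D.gCoord (coord e) x i j - (1 : Matrix (Fin 3) (Fin 3) ℝ) i j) (-q)
  k_decay : ∀ e i j, IsBigOOrder 1 (fun x => D.kCoord (coord e) x i j) (-p)
  massDensity_decay : ∀ e,
    massDensity (D.gCoord (coord e)) (D.kCoord (coord e))
      =O[Bornology.cobounded E3] fun x => ‖x‖ ^ (-3 - ε)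
  currentDensity_decay : ∀ e,
    currentLength (D.gCoord (coord e)) (D.kCoord (coord e))
      =O[Bornology.cobounded E3] fun x => ‖x‖ ^ (-3 - ε)

end InitialDataSet

end Manifold

/-! ### Tensors on the sphere and the angular momentum -/

/-- The standard area measure on the unit sphere `S²` of `E3` (total mass `4π`). -/
def sphereArea : Measure (Metric.sphere (0 : E3) 1) := (volume : Measure E3).toSphere

/-- The extension of a tensor `A` along the unit sphere to `E3 ∖ {0}`, with Cartesian components
independent of `r`. Only the values of `A` on the unit sphere matter. -/
def radialExt (A : TensorField) : TensorField := fun x => A (‖x‖⁻¹ • x)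

/-- `A` restricts to a continuously differentiable tensor along the unit sphere. -/
def IsC1OnSphere (A : TensorField) : Prop :=
  ∀ i j, ContDiffOn ℝ 1 (fun x => radialExt A x i j) {0}ᶜ

/-- The expansion `π = A r^(-p) + B r^(-3) + o_1(r^(-3))`, with `A` and `B` independent of `r`. -/
def HasMomentumExpansion (π A B : TensorField) (p : ℝ) : Prop :=
  ∀ i j, IsLittleOOrder 1
    (fun x => π x i j - (radialExt A x i j * ‖x‖ ^ (-p) + radialExt B x i j * ‖x‖ ^ (-3 : ℝ))) (-3)

/-- The rotation field `Y = ∂ᵢ × x` about the `i`-th coordinate axis. -/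
def rotationField (i : Fin 3) (x : E3) : Fin 3 → ℝ :=
  crossProduct (Pi.single i 1) (fun j => x j)

/-- The integrand `∑ⱼₖ πⱼₖ Yʲ xᵏ / |x|` of the angular momentum about the `i`-th axis. -/
def angularIntegrand (π : TensorField) (i : Fin 3) (x : E3) : ℝ :=
  ∑ j, ∑ k, π x j k * rotationField i x j * (x k / ‖x‖)

/-- The integral `∫_{|x| = r} ∑ⱼₖ πⱼₖ Yʲ xᵏ / |x| dσ₀`, with `dσ₀` the standard area measure of the
sphere of radius `r`, written as `r²` times an integral over the unit sphere. -/
def angularFlux (π : TensorField) (i : Fin 3) (r : ℝ) : ℝ :=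
  r ^ 2 * ∫ θ, angularIntegrand π i (r • (θ : E3)) ∂sphereArea

/-- The ADM angular momentum `J(Y) = (1 / 8π) lim_{r → ∞} ∫_{|x| = r} ∑ⱼₖ πⱼₖ Yʲ xᵏ / |x| dσ₀` about
the `i`-th axis exists and equals the real number `L`. -/
def HasADMAngularMomentum (π : TensorField) (i : Fin 3) (L : ℝ) : Prop :=
  (∀ᶠ r : ℝ in atTop,
    Integrable (fun θ : Metric.sphere (0 : E3) 1 => angularIntegrand π i (r • (θ : E3))) sphereArea) ∧
  Tendsto (fun r : ℝ => 1 / (8 * Real.pi) * angularFlux π i r) atTop (𝓝 L)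

/-- The covector field `x ↦ B(·, x / |x|)` with `B` extended independently of `r`. Its restriction
to the tangent spaces of the unit sphere is the mixed radial-tangential part of `B`. -/
def mixedPart (B : TensorField) (j : Fin 3) (x : E3) : ℝ :=
  ∑ k, radialExt B x j k * (x k / ‖x‖)

/-- At a point `x` of the unit sphere, the value `*dα` for the one-form `α` on the sphere obtained by
restricting the covector field `a` to tangent vectors, `*` being the Hodge star of the unit sphere
oriented by its outer normal: the normal component `x · curl a` of the curl of `a`. -/
def starD (a : Fin 3 → E3 → ℝ) (x : E3) : ℝ :=
  x 0 * (partialD 1 (a 2) x - partialD 2 (a 1) x)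
    + x 1 * (partialD 2 (a 0) x - partialD 0 (a 2) x)
    + x 2 * (partialD 0 (a 1) x - partialD 1 (a 0) x)

end

/-! The only threat to convergence is the `r^(-p)` term: since `Y` grows like `r`, it contributes
`r^(3-p)` times a fixed integral over the unit sphere, and `p < 3`. The point is that the momentum
constraint forces this integral to vanish.

The Euclidean divergence of `π` agrees with the current density up to products of `g - δ` and `∂g`
with `∂k`, `k` or the trace, of size `r^(-p-q-1)` (`decaysAt_divergence_conjugateMomentum_sub`). The
current density and the divergence of the `r^(-3)` part of `π` are both `O(r^(-4))`. Hence the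
divergence of the leading term, which is homogeneous of degree `-p-1`, decays strictly faster than
its degree allows, so it is zero (`eq_zero_of_homogeneous_of_decaysAt`,
`HasMomentumExpansion.divergence_leading_eq_zero`). The same comparison shows that the leading term
is symmetric.

A symmetric divergence-free tensor contracted with a Killing field `Y` is a divergence-free vector
field, here homogeneous of degree `1-p`. Its flux through the sphere of radius `r` is independent of
`r` and also proportional to `r^(3-p)`, so it is zero. In the proof this is the identity `∫ div W =
(s+2) ∫ W·x` on the unit sphere for `W` homogeneous of degree `s`
(`IsC1Homogeneous.integral_partialD`, `integral_angularIntegrand_eq_zero`). What survives is the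
`r^(-3)` term, whose flux does not depend on `r`; the remainder contributes `o(1)`.

The second formula is integration by parts on the closed sphere: `d(x^i α)` integrates to zero, and
`dx^i ∧ α` is, up to sign, the area form times `α(Y)` (`starD_coord_mul`, `integral_starD_eq_zero`).
-/

/-! ### Homogeneous functions -/

/-- `f` is continuously differentiable away from the origin and positively homogeneous of
degree `s`. -/
structure IsC1Homogeneous (f : E3 → ℝ) (s : ℝ) : Prop where
  contDiffOn : ContDiffOn ℝ 1 f {0}ᶜ
  map_smul : ∀ t : ℝ, 0 < t → ∀ x : E3, x ≠ 0 → f (t • x) = t ^ s * f x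

namespace IsC1Homogeneous

variable {f g : E3 → ℝ} {s t : ℝ}

theorem contDiffAt (hf : IsC1Homogeneous f s) {x : E3} (hx : x ≠ 0) : ContDiffAt ℝ 1 f x :=
  hf.contDiffOn.contDiffAt (isOpen_compl_singleton.mem_nhds hx)

theorem differentiableAt (hf : IsC1Homogeneous f s) {x : E3} (hx : x ≠ 0) :
    DifferentiableAt ℝ f x :=
  (hf.contDiffAt hx).differentiableAt one_ne_zero

theorem add (hf : IsC1Homogeneous f s) (hg : IsC1Homogeneous g s) :
    IsC1Homogeneous (fun x => f x + g x) s where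
  contDiffOn := hf.contDiffOn.add hg.contDiffOn
  map_smul r hr x hx := by simp only [hf.map_smul r hr x hx, hg.map_smul r hr x hx]; ring

theorem neg (hf : IsC1Homogeneous f s) : IsC1Homogeneous (fun x => -f x) s where
  contDiffOn := hf.contDiffOn.neg
  map_smul r hr x hx := by simp only [hf.map_smul r hr x hx]; ring

theorem sub (hf : IsC1Homogeneous f s) (hg : IsC1Homogeneous g s) :
    IsC1Homogeneous (fun x => f x - g x) s := by
  simpa only [sub_eq_add_neg] using hf.add hg.neg

theorem mul (hf : IsC1Homogeneous f s) (hg : IsC1Homogeneous g t) :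
    IsC1Homogeneous (fun x => f x * g x) (s + t) where
  contDiffOn := hf.contDiffOn.mul hg.contDiffOn
  map_smul r hr x hx := by
    simp only [hf.map_smul r hr x hx, hg.map_smul r hr x hx, Real.rpow_add hr]; ring

theorem sum {ι : Type*} {u : Finset ι} {F : ι → E3 → ℝ} (hF : ∀ i ∈ u, IsC1Homogeneous (F i) s) :
    IsC1Homogeneous (fun x => ∑ i ∈ u, F i x) s where
  contDiffOn := ContDiffOn.sum fun i hi => (hF i hi).contDiffOn
  map_smul r hr x hx := by
    rw [Finset.mul_sum]
    exact Finset.sum_congr rfl fun i hi => (hF i hi).map_smul r hr x hx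

theorem coord (k : Fin 3) : IsC1Homogeneous (fun x => x k) 1 where
  contDiffOn := ((EuclideanSpace.proj k : E3 →L[ℝ] ℝ).contDiff).contDiffOn
  map_smul r hr x hx := by simp

theorem norm_rpow (a : ℝ) : IsC1Homogeneous (fun x => ‖x‖ ^ a) a where
  contDiffOn x hx := ((contDiffAt_norm ℝ hx).rpow_const_of_ne (norm_ne_zero_iff.2 hx)).contDiffWithinAt
  map_smul r hr x hx := by
    rw [norm_smul, Real.norm_of_nonneg hr.le, Real.mul_rpow hr.le (norm_nonneg x)]

theorem congr_degree (hf : IsC1Homogeneous f s) (h : s = t) : IsC1Homogeneous f t := h ▸ hf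

/-- Differentiate `f (r • y) = r ^ s * f y` in `y` in two ways; the chain rule puts a factor `r` on
the left, which lowers the degree by one. -/
theorem fderiv_smul (hf : IsC1Homogeneous f s) {r : ℝ} (hr : 0 < r) {x : E3} (hx : x ≠ 0) :
    fderiv ℝ f (r • x) = r ^ (s - 1) • fderiv ℝ f x := by
  have hrx : r • x ≠ 0 := smul_ne_zero hr.ne' hx
  have h1 : HasFDerivAt (fun y => f (r • y)) ((fderiv ℝ f (r • x)).comp
      (r • ContinuousLinearMap.id ℝ E3)) x :=
    (hf.differentiableAt hrx).hasFDerivAt.comp x ((hasFDerivAt_id x).const_smul r)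
  have h2 : HasFDerivAt (fun y => f (r • y)) (r ^ s • fderiv ℝ f x) x := by
    refine ((hf.differentiableAt hx).hasFDerivAt.const_mul (r ^ s)).congr_of_eventuallyEq ?_
    filter_upwards [isOpen_compl_singleton.mem_nhds hx] with y hy using hf.map_smul r hr y hy
  have h3 := h1.unique h2
  ext v
  have h4 := congrArg (fun T : E3 →L[ℝ] ℝ => T v) h3
  simp only [ContinuousLinearMap.comp_apply, _root_.smul_apply,
    ContinuousLinearMap.id_apply, smul_eq_mul, ContinuousLinearMap.map_smul] at h4 ⊢
  rw [Real.rpow_sub_one hr.ne', div_mul_eq_mul_div, ← h4]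
  field_simp

theorem continuousOn_fderiv (hf : IsC1Homogeneous f s) : ContinuousOn (fderiv ℝ f) {0}ᶜ :=
  hf.contDiffOn.continuousOn_fderiv_of_isOpen isOpen_compl_singleton le_rfl

theorem continuousOn_partialD (hf : IsC1Homogeneous f s) (k : Fin 3) :
    ContinuousOn (partialD k f) {0}ᶜ :=
  hf.continuousOn_fderiv.clm_apply continuousOn_const

end IsC1Homogeneous

/-! ### Integration in polar coordinates -/

theorem ne_zero_of_mem_unitSphere (θ : Metric.sphere (0 : E3) 1) : (θ : E3) ≠ 0 :=
  ne_zero_of_mem_unit_sphere θ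

instance : IsFiniteMeasure sphereArea := by unfold sphereArea; infer_instance

theorem ContinuousOn.integrable_sphereArea {f : E3 → ℝ} (hf : ContinuousOn f {0}ᶜ) :
    Integrable (fun θ : Metric.sphere (0 : E3) 1 => f θ) sphereArea := by
  have : Continuous fun θ : Metric.sphere (0 : E3) 1 => f θ :=
    hf.comp_continuous continuous_subtype_val ne_zero_of_mem_unitSphere
  exact this.integrable_of_hasCompactSupport (HasCompactSupport.of_compactSpace _)

/-- Integration in polar coordinates on `E3`. -/
theorem integral_eq_integral_sphere_Ioi {F : E3 → ℝ} (hF : Integrable F) :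
    ∫ x, F x = ∫ θ : Metric.sphere (0 : E3) 1,
      (∫ r in Ioi (0 : ℝ), r ^ 2 * F (r • (θ : E3))) ∂sphereArea := by
  have hmp := (volume : Measure E3).measurePreserving_homeomorphUnitSphereProd
  have hdim : Module.finrank ℝ E3 - 1 = 2 := by simp
  rw [hdim] at hmp
  have hemb := (homeomorphUnitSphereProd E3).measurableEmbedding
  let G : Metric.sphere (0 : E3) 1 × Ioi (0 : ℝ) → ℝ := fun z => F (z.2.1 • (z.1 : E3))
  have hG : ∀ x : ({0}ᶜ : Set E3), G (homeomorphUnitSphereProd E3 x) = F x := by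
    intro x
    simp only [G, homeomorphUnitSphereProd_apply_fst_coe, homeomorphUnitSphereProd_apply_snd_coe]
    rw [smul_inv_smul₀ (norm_ne_zero_iff.2 x.2)]
  have hi : Integrable G
      ((volume : Measure E3).toSphere.prod (Measure.volumeIoiPow 2)) := by
    rw [← hmp.integrable_comp_emb hemb]
    have : G ∘ (homeomorphUnitSphereProd E3) = F ∘ Subtype.val := funext hG
    rw [this, ← integrableOn_iff_comap_subtypeVal (measurableSet_singleton _).compl]
    exact hF.integrableOn
  have h1 : ∫ x, F x = ∫ x : ({0}ᶜ : Set E3), F x ∂((volume : Measure E3).comap (↑)) := by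
    rw [integral_subtype_comap (measurableSet_singleton _).compl F, restrict_compl_singleton]
  rw [h1, ← integral_congr_ae (ae_of_all _ hG), hmp.integral_comp hemb G, integral_prod _ hi]
  refine integral_congr_ae (ae_of_all _ fun θ => ?_)
  simp only [G, Measure.volumeIoiPow]
  refine (integral_withDensity_eq_integral_smul (by fun_prop) _).trans ?_
  rw [integral_subtype_comap measurableSet_Ioi
      fun a : ℝ => Real.toNNReal (a ^ 2) • F (a • (θ : E3))]
  refine setIntegral_congr_fun measurableSet_Ioi fun r hr => ?_
  simp [NNReal.smul_def, Real.coe_toNNReal _ (sq_nonneg r)]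

/-! ### The divergence theorem for homogeneous functions on the sphere -/

/-- The integral of a partial derivative of a compactly supported `C¹` function vanishes. -/
theorem integral_partialD_eq_zero {u : E3 → ℝ} (hu : ContDiff ℝ 1 u) (hc : HasCompactSupport u)
    (k : Fin 3) : Integrable (partialD k u) ∧ ∫ x, partialD k u x = 0 := by
  have hi : Integrable (partialD k u) :=
    (((hu.continuous_fderiv one_ne_zero).clm_apply continuous_const).integrable_of_hasCompactSupport
      (hc.fderiv_apply (𝕜 := ℝ) _))
  refine ⟨hi, ?_⟩
  -- Integration by parts against the constant function `1`, whose derivative vanishes.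
  have h := integral_mul_fderiv_eq_neg_fderiv_mul_of_integrable (μ := (volume : Measure E3))
    (f := fun _ => (1 : ℝ)) (g := u) (v := basisVec k) (by simp) (by simpa using! hi)
    (by simpa using hu.continuous.integrable_of_hasCompactSupport hc)
    (fun _ _ => differentiableAt_const _) (fun x _ => hu.differentiable one_ne_zero x)
  simpa using! h

theorem partialD_norm {x : E3} (hx : x ≠ 0) (k : Fin 3) :
    partialD k (fun y => ‖y‖) x = x k / ‖x‖ := by
  have h1 : HasFDerivAt (fun y : E3 => ‖y‖ ^ 2) (2 • innerSL ℝ x) x :=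
    (hasStrictFDerivAt_norm_sq x).hasFDerivAt
  have hd : DifferentiableAt ℝ (fun y : E3 => ‖y‖) x := differentiableAt_id.norm ℝ hx
  have h2 := (hd.hasFDerivAt.pow 2).unique h1
  have h3 := congrArg (fun T : E3 →L[ℝ] ℝ => T (basisVec k)) h2
  have hn : ‖x‖ ≠ 0 := norm_ne_zero_iff.2 hx
  simp [basisVec, EuclideanSpace.inner_single_right] at h3
  unfold partialD basisVec
  rw [eq_div_iff hn]
  linarith

/-- For `f` homogeneous of degree `s`, the integral of `∂ₖ f` over the unit sphere is
`(s + 2)` times the integral of `f` against the `k`-th component of the outer normal. -/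
theorem IsC1Homogeneous.integral_partialD {f : E3 → ℝ} {s : ℝ} (hf : IsC1Homogeneous f s)
    (k : Fin 3) :
    ∫ θ, partialD k f (θ : E3) ∂sphereArea
      = (s + 2) * ∫ θ, (θ : E3) k * f θ ∂sphereArea := by
  -- The identity on the sphere is read off from `∫ ∂ₖ(φ(‖x‖) f) = 0` over the whole space. The
  -- radial cutoff `φ` lives in `[3/2, 5/2]`, away from the origin, where `f` need not be smooth. In
  -- polar coordinates homogeneity separates the radial factor.
  let φ : ContDiffBump (2 : ℝ) := ⟨1 / 4, 1 / 2, by norm_num, by norm_num⟩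
  have hφ : ContDiff ℝ 1 φ := φ.contDiff
  have hφ0 : ∀ r : ℝ, r ∉ Icc (3 / 2 : ℝ) (5 / 2) → φ r = 0 := by
    intro r hr
    refine φ.zero_of_le_dist ?_
    by_contra h
    rw [not_le, Real.dist_eq, abs_lt] at h
    change -(1 / 2 : ℝ) < r - 2 ∧ r - 2 < (1 / 2 : ℝ) at h
    exact hr ⟨by linarith, by linarith⟩
  have hdφ0 : ∀ r : ℝ, r ∉ Icc (3 / 2 : ℝ) (5 / 2) → deriv φ r = 0 := by
    intro r hr
    have : (φ : ℝ → ℝ) =ᶠ[𝓝 r] fun _ => 0 := by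
      filter_upwards [isClosed_Icc.isOpen_compl.mem_nhds hr] with y hy
      exact hφ0 y hy
    rw [this.deriv_eq, deriv_const]
  let u : E3 → ℝ := fun x => φ ‖x‖ * f x
  have hu : ContDiff ℝ 1 u := by
    rw [contDiff_iff_contDiffAt]
    intro x
    rcases eq_or_ne x 0 with rfl | hx
    · refine (contDiffAt_const (c := (0 : ℝ))).congr_of_eventuallyEq ?_
      filter_upwards [Metric.ball_mem_nhds (0 : E3) one_pos] with y hy
      rw [mem_ball_zero_iff] at hy
      simp only [u]
      rw [hφ0 _ fun h => by linarith [h.1], zero_mul]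
    · exact ((hφ.contDiffAt).comp x (contDiffAt_norm ℝ hx)).mul (hf.contDiffAt hx)
  have hc : HasCompactSupport u := by
    refine HasCompactSupport.of_support_subset_isCompact (isCompact_closedBall (0 : E3) 3) ?_
    intro x hx
    rw [mem_closedBall_zero_iff]
    by_contra h
    exact hx (by simp only [u]; rw [hφ0 _ fun h' => h (by linarith [h'.2]), zero_mul])
  have hpu : ∀ x : E3, x ≠ 0 → partialD k u x
      = deriv φ ‖x‖ * (x k / ‖x‖) * f x + φ ‖x‖ * partialD k f x := by
    intro x hx
    have hn : HasFDerivAt (fun y : E3 => ‖y‖) (fderiv ℝ (fun y : E3 => ‖y‖) x) x :=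
      (differentiableAt_id.norm ℝ hx).hasFDerivAt
    have h1 : HasFDerivAt (fun y : E3 => φ ‖y‖) (deriv φ ‖x‖ • fderiv ℝ (fun y : E3 => ‖y‖) x) x :=
      ((hφ.differentiable one_ne_zero ‖x‖).hasDerivAt).comp_hasFDerivAt x hn
    have h2 := (h1.mul (hf.differentiableAt hx).hasFDerivAt).fderiv
    rw [← partialD_norm hx]
    change fderiv ℝ ((fun y => φ ‖y‖) * f) x _ = _
    rw [h2]
    simp only [partialD, _root_.add_apply, _root_.smul_apply, smul_eq_mul]
    ring
  obtain ⟨hui, hu0⟩ := integral_partialD_eq_zero hu hc k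
  rw [integral_eq_integral_sphere_Ioi hui] at hu0
  set C : ℝ := ∫ r in (1 : ℝ)..3, φ r * r ^ (s + 1) with hC
  have hcont : ∀ a : ℝ, ContinuousOn (fun r : ℝ => r ^ a) (Icc 1 3) := fun a r hr =>
    (Real.continuousAt_rpow_const r a (Or.inl (by linarith [hr.1]))).continuousWithinAt
  have hcφ : ContinuousOn (fun r : ℝ => φ r * r ^ (s + 1)) (Icc 1 3) :=
    hφ.continuous.continuousOn.mul (hcont _)
  have hcφ' : ContinuousOn (fun r : ℝ => deriv φ r * r ^ (s + 2)) (Icc 1 3) :=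
    (hφ.continuous_deriv le_rfl).continuousOn.mul (hcont _)
  have h13 : (1 : ℝ) ≤ 3 := by norm_num
  have hint : ∀ {v : ℝ → ℝ}, ContinuousOn v (Icc 1 3) → IntervalIntegrable v volume 1 3 :=
    fun h => ContinuousOn.intervalIntegrable (by rwa [uIcc_of_le h13])
  have hCpos : 0 < C := by
    refine intervalIntegral.integral_pos (by norm_num) hcφ
      (fun r hr => mul_nonneg φ.nonneg (Real.rpow_nonneg (by linarith [hr.1]) _))
      ⟨2, by norm_num, mul_pos ?_ (by positivity)⟩
    exact φ.pos_of_mem_ball (Metric.mem_ball_self (by norm_num))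
  -- Integration by parts in `r`; `φ` vanishes at both endpoints. This is where the factor `s + 2`
  -- comes from, and `C > 0` can be cancelled at the end.
  have hD : ∫ r in (1 : ℝ)..3, deriv φ r * r ^ (s + 2) = -(s + 2) * C := by
    have h := intervalIntegral.integral_eq_sub_of_hasDerivAt (a := 1) (b := 3)
      (f := fun r : ℝ => φ r * r ^ (s + 2))
      (f' := fun r : ℝ => deriv φ r * r ^ (s + 2) + (s + 2) * (φ r * r ^ (s + 1))) (fun r hr => ?_)
      ((hint hcφ').add ((hint hcφ).const_mul _))
    · rw [intervalIntegral.integral_add (hint hcφ') ((hint hcφ).const_mul _),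
        intervalIntegral.integral_const_mul, ← hC, hφ0 3 (by norm_num), hφ0 1 (by norm_num)] at h
      linarith
    · rw [uIcc_of_le h13] at hr
      have hr0 : r ≠ 0 := by linarith [hr.1]
      have := ((hφ.differentiable one_ne_zero r).hasDerivAt).mul
        (Real.hasDerivAt_rpow_const (x := r) (p := s + 2) (Or.inl hr0))
      refine this.congr_deriv ?_
      rw [show s + 2 - 1 = s + 1 by ring]
      ring
  have hinner : ∀ θ : Metric.sphere (0 : E3) 1,
      ∫ r in Ioi (0 : ℝ), r ^ 2 * partialD k u (r • (θ : E3))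
        = C * (partialD k f θ - (s + 2) * ((θ : E3) k * f θ)) := by
    intro θ
    have hθ := ne_zero_of_mem_unitSphere θ
    have hθ1 : ‖(θ : E3)‖ = 1 := norm_eq_of_mem_sphere θ
    have h1 : ∀ r ∈ Ioi (0 : ℝ), r ^ 2 * partialD k u (r • (θ : E3))
        = (θ : E3) k * f θ * (deriv φ r * r ^ (s + 2))
          + partialD k f θ * (φ r * r ^ (s + 1)) := by
      intro r hr
      have hr : 0 < r := hr
      rw [hpu _ (smul_ne_zero hr.ne' hθ), hf.map_smul r hr _ hθ, norm_smul, hθ1, mul_one,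
        Real.norm_of_nonneg hr.le]
      simp only [partialD]
      rw [hf.fderiv_smul hr hθ, show s + 2 = s + (2 : ℕ) by norm_num,
        show s + 1 = s - 1 + (2 : ℕ) by push_cast; ring, Real.rpow_add_natCast hr.ne',
        Real.rpow_add_natCast hr.ne']
      simp only [PiLp.smul_apply, _root_.smul_apply, smul_eq_mul]
      field_simp
    rw [setIntegral_congr_fun measurableSet_Ioi h1]
    rw [setIntegral_eq_of_subset_of_forall_sdiff_eq_zero measurableSet_Ioi (s := Ioc 1 3)
      (fun r hr => lt_trans one_pos hr.1) ?_, ← intervalIntegral.integral_of_le h13,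
      intervalIntegral.integral_add ((hint hcφ').const_mul _) ((hint hcφ).const_mul _),
      intervalIntegral.integral_const_mul, intervalIntegral.integral_const_mul, hD, ← hC]
    · ring
    · rintro r ⟨hr0, hr⟩
      have hr' : r ∉ Icc (3 / 2 : ℝ) (5 / 2) := fun h =>
        hr ⟨by linarith [h.1], by linarith [h.2]⟩
      simp only [hφ0 r hr', hdφ0 r hr', zero_mul, mul_zero, add_zero]
  simp only [hinner] at hu0
  rw [integral_const_mul, mul_eq_zero, or_iff_right hCpos.ne', integral_sub
    (hf.continuousOn_partialD k).integrable_sphereArea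
    (((((IsC1Homogeneous.coord k).mul hf).contDiffOn.continuousOn).integrable_sphereArea).const_mul _),
    integral_const_mul] at hu0
  linarith

/-! ### Partial derivatives -/

theorem partialD_mul {f g : E3 → ℝ} {x : E3} (hf : DifferentiableAt ℝ f x)
    (hg : DifferentiableAt ℝ g x) (k : Fin 3) :
    partialD k (fun y => f y * g y) x = partialD k f x * g x + f x * partialD k g x := by
  have h := (hf.hasFDerivAt.mul hg.hasFDerivAt).fderiv
  change fderiv ℝ (f * g) x _ = _
  rw [h]
  simp only [partialD, _root_.add_apply, _root_.smul_apply, smul_eq_mul]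
  ring

theorem partialD_sub {f g : E3 → ℝ} {x : E3} (hf : DifferentiableAt ℝ f x)
    (hg : DifferentiableAt ℝ g x) (k : Fin 3) :
    partialD k (fun y => f y - g y) x = partialD k f x - partialD k g x := by
  simp only [partialD]
  rw [fderiv_fun_sub hf hg, _root_.sub_apply]

theorem partialD_sum {ι : Type*} {u : Finset ι} {F : ι → E3 → ℝ} {x : E3}
    (hF : ∀ i ∈ u, DifferentiableAt ℝ (F i) x) (k : Fin 3) :
    partialD k (fun y => ∑ i ∈ u, F i y) x = ∑ i ∈ u, partialD k (F i) x := by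
  simp only [partialD]
  rw [fderiv_fun_sum hF, _root_.sum_apply]

theorem partialD_coord (k m : Fin 3) (x : E3) :
    partialD k (fun y => y m) x = if m = k then 1 else 0 := by
  have h : HasFDerivAt (fun y : E3 => y m) (EuclideanSpace.proj m : E3 →L[ℝ] ℝ) x :=
    (EuclideanSpace.proj m : E3 →L[ℝ] ℝ).hasFDerivAt
  unfold partialD
  rw [h.fderiv]
  simp [basisVec]

theorem differentiableAt_coord (m : Fin 3) (x : E3) : DifferentiableAt ℝ (fun y : E3 => y m) x :=
  (EuclideanSpace.proj m : E3 →L[ℝ] ℝ).differentiableAt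

/-! ### Rotation fields -/

theorem rotationField_zero (x : E3) : rotationField 0 x = ![0, -x 2, x 1] := by
  ext j; fin_cases j <;> simp [rotationField, crossProduct]

theorem rotationField_one (x : E3) : rotationField 1 x = ![x 2, 0, -x 0] := by
  ext j; fin_cases j <;> simp [rotationField, crossProduct]

theorem rotationField_two (x : E3) : rotationField 2 x = ![-x 1, x 0, 0] := by
  ext j; fin_cases j <;> simp [rotationField, crossProduct]

/-- The rotation fields as continuous linear functionals, component by component. -/
noncomputable def rotationCLM (i j : Fin 3) : E3 →L[ℝ] ℝ :=
  ∑ m, rotationField i (basisVec m) j • (EuclideanSpace.proj m : E3 →L[ℝ] ℝ)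

theorem rotationCLM_apply (i j : Fin 3) (x : E3) : rotationCLM i j x = rotationField i x j := by
  fin_cases i <;> fin_cases j <;>
    simp [rotationCLM, basisVec, rotationField_zero, rotationField_one,
      rotationField_two]

theorem rotationField_eq (i j : Fin 3) : (fun x => rotationField i x j) = rotationCLM i j :=
  funext fun x => (rotationCLM_apply i j x).symm

theorem isC1Homogeneous_rotationField (i j : Fin 3) :
    IsC1Homogeneous (fun x => rotationField i x j) 1 where
  contDiffOn := by rw [rotationField_eq]; exact (rotationCLM i j).contDiff.contDiffOn
  map_smul t ht x hx := by simp [← rotationCLM_apply]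

theorem rotationField_smul (i j : Fin 3) (t : ℝ) (x : E3) :
    rotationField i (t • x) j = t * rotationField i x j := by
  simp [← rotationCLM_apply]

theorem partialD_rotationField (i j k : Fin 3) (x : E3) :
    partialD k (fun y => rotationField i y j) x = rotationField i (basisVec k) j := by
  rw [rotationField_eq, partialD, (rotationCLM i j).fderiv, rotationCLM_apply]

/-- The Killing equation: the constant matrix `∂ₖ Yʲ` is antisymmetric, so its contraction with a
symmetric tensor vanishes. -/
theorem rotationField_basisVec_antisymm (i j k : Fin 3) :
    rotationField i (basisVec k) j = -rotationField i (basisVec j) k := by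
  fin_cases i <;> fin_cases j <;> fin_cases k <;>
    simp [basisVec, rotationField_zero, rotationField_one, rotationField_two]

/-! ### Flux and divergence of homogeneous fields -/

theorem isC1Homogeneous_radialExt {A : TensorField} (hA : IsC1OnSphere A) (i j : Fin 3) :
    IsC1Homogeneous (fun x => radialExt A x i j) 0 where
  contDiffOn := hA i j
  map_smul t ht x hx := by
    have : ‖t • x‖⁻¹ • t • x = ‖x‖⁻¹ • x := by
      rw [norm_smul, Real.norm_of_nonneg ht.le, smul_smul]
      congr 1
      field_simp
    simp only [radialExt, this, Real.rpow_zero, one_mul]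

theorem radialExt_coe_sphere (A : TensorField) (θ : Metric.sphere (0 : E3) 1) :
    radialExt A (θ : E3) = A θ := by
  simp [radialExt, norm_eq_of_mem_sphere θ]

/-- The divergence theorem on the unit sphere for a homogeneous vector field of degree `s`. -/
theorem integral_divergence_eq_flux {W : Fin 3 → E3 → ℝ} {s : ℝ}
    (hW : ∀ k, IsC1Homogeneous (W k) s) :
    ∫ θ, ∑ k, partialD k (W k) (θ : E3) ∂sphereArea
      = (s + 2) * ∫ θ, ∑ k, (θ : E3) k * W k θ ∂sphereArea := by
  rw [integral_finsetSum _ fun k _ => ((hW k).continuousOn_partialD k).integrable_sphereArea,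
    integral_finsetSum _ fun k _ =>
      (((IsC1Homogeneous.coord k).mul (hW k)).contDiffOn.continuousOn).integrable_sphereArea,
    Finset.mul_sum]
  exact Finset.sum_congr rfl fun k _ => (hW k).integral_partialD k

theorem angularIntegrand_coe_sphere (A : TensorField) (i : Fin 3) (θ : Metric.sphere (0 : E3) 1) :
    angularIntegrand A i (θ : E3)
      = ∑ k, (θ : E3) k * ∑ j, radialExt A (θ : E3) j k * rotationField i θ j := by
  simp only [angularIntegrand, norm_eq_of_mem_sphere θ, radialExt_coe_sphere, Finset.mul_sum,
    div_one]
  rw [Finset.sum_comm]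
  exact Finset.sum_congr rfl fun k _ => Finset.sum_congr rfl fun j _ => by ring

theorem continuousOn_angularIntegrand_radialExt {A : TensorField} (hA : IsC1OnSphere A)
    (i : Fin 3) : ContinuousOn (fun x => ∑ k, x k * ∑ j, radialExt A x j k * rotationField i x j)
      {0}ᶜ :=
  (IsC1Homogeneous.sum fun k _ => (IsC1Homogeneous.coord k).mul (IsC1Homogeneous.sum fun j _ =>
    (isC1Homogeneous_radialExt hA j k).mul
      (isC1Homogeneous_rotationField i j))).contDiffOn.continuousOn

theorem integrable_angularIntegrand_sphere {A : TensorField} (hA : IsC1OnSphere A) (i : Fin 3) :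
    Integrable (fun θ : Metric.sphere (0 : E3) 1 => angularIntegrand A i (θ : E3)) sphereArea := by
  simp only [angularIntegrand_coe_sphere]
  exact (continuousOn_angularIntegrand_radialExt hA i).integrable_sphereArea

/-- If the symmetric tensor `A r^(-p)` is divergence free, the leading term of the angular momentum
flux vanishes. -/
theorem integral_angularIntegrand_eq_zero {A : TensorField} (hA : IsC1OnSphere A) {p : ℝ}
    (hp : p ≠ 3) (hsymm : ∀ x : E3, x ≠ 0 → ∀ j k, radialExt A x j k = radialExt A x k j)
    (hdiv : ∀ x : E3, x ≠ 0 → ∀ j,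
      ∑ k, partialD k (fun y => radialExt A y j k * ‖y‖ ^ (-p)) x = 0) (i : Fin 3) :
    ∫ θ, angularIntegrand A i (θ : E3) ∂sphereArea = 0 := by
  have hP : ∀ j k, IsC1Homogeneous (fun x => radialExt A x j k * ‖x‖ ^ (-p)) (0 + -p) :=
    fun j k => (isC1Homogeneous_radialExt hA j k).mul (IsC1Homogeneous.norm_rpow _)
  have hT : ∀ j k, IsC1Homogeneous
      (fun x => radialExt A x j k * ‖x‖ ^ (-p) * rotationField i x j) (0 + -p + 1) :=
    fun j k => (hP j k).mul (isC1Homogeneous_rotationField i j)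
  have h := integral_divergence_eq_flux (s := 0 + -p + 1)
    (W := fun k x => ∑ j, radialExt A x j k * ‖x‖ ^ (-p) * rotationField i x j)
    fun k => IsC1Homogeneous.sum fun j _ => hT j k
  have h1 : ∀ x : E3, x ≠ 0 → ∑ k, partialD k
      (fun x => ∑ j, radialExt A x j k * ‖x‖ ^ (-p) * rotationField i x j) x = 0 := by
    intro x hx
    have h2 : ∀ k, partialD k
        (fun x => ∑ j, radialExt A x j k * ‖x‖ ^ (-p) * rotationField i x j) x
        = ∑ j, (partialD k (fun y => radialExt A y j k * ‖y‖ ^ (-p)) x * rotationField i x j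
          + radialExt A x j k * ‖x‖ ^ (-p) * rotationField i (basisVec k) j) := by
      intro k
      rw [partialD_sum fun j _ => (hT j k).differentiableAt hx]
      refine Finset.sum_congr rfl fun j _ => ?_
      rw [partialD_mul ((hP j k).differentiableAt hx)
        ((isC1Homogeneous_rotationField i j).differentiableAt hx), partialD_rotationField]
    have h3 : ∑ k, ∑ j, radialExt A x j k * ‖x‖ ^ (-p) * rotationField i (basisVec k) j = 0 := by
      have h4 : ∑ k, ∑ j, radialExt A x j k * ‖x‖ ^ (-p) * rotationField i (basisVec k) j
          = -∑ k, ∑ j, radialExt A x j k * ‖x‖ ^ (-p) * rotationField i (basisVec k) j := by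
        conv_lhs => rw [Finset.sum_comm]
        rw [← Finset.sum_neg_distrib]
        refine Finset.sum_congr rfl fun k _ => ?_
        rw [← Finset.sum_neg_distrib]
        refine Finset.sum_congr rfl fun j _ => ?_
        rw [rotationField_basisVec_antisymm, hsymm x hx k j]
        ring
      linarith
    simp only [h2, Finset.sum_add_distrib, h3, add_zero]
    rw [Finset.sum_comm]
    simp only [← Finset.sum_mul, hdiv x hx, zero_mul, Finset.sum_const_zero]
  have h5 : ∀ θ : Metric.sphere (0 : E3) 1,
      ∑ k, (θ : E3) k * ∑ j, radialExt A θ j k * ‖(θ : E3)‖ ^ (-p) * rotationField i θ j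
        = angularIntegrand A i (θ : E3) := by
    intro θ
    simp only [angularIntegrand_coe_sphere, norm_eq_of_mem_sphere θ, Real.one_rpow, mul_one]
  simp only [h1 _ (ne_zero_of_mem_unitSphere _), h5, integral_zero] at h
  -- The factor is `s + 2 = 3 - p`, nonzero exactly because `p ≠ 3`.
  refine (mul_eq_zero.1 h.symm).resolve_left fun h6 => hp (by linarith)

theorem isC1Homogeneous_mixedPart {B : TensorField} (hB : IsC1OnSphere B) (j : Fin 3) :
    IsC1Homogeneous (mixedPart B j) 0 := by
  have : mixedPart B j = fun x => ∑ k, radialExt B x j k * (x k * ‖x‖ ^ (-1 : ℝ)) := by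
    funext x
    simp only [mixedPart, Real.rpow_neg_one, div_eq_mul_inv]
  rw [this]
  refine IsC1Homogeneous.sum fun k _ => ?_
  exact ((isC1Homogeneous_radialExt hB j k).mul ((IsC1Homogeneous.coord k).mul
    (IsC1Homogeneous.norm_rpow (-1)))).congr_degree (by norm_num)

/-- The integral over the unit sphere of `x · curl b` vanishes. -/
theorem integral_starD_eq_zero {b : Fin 3 → E3 → ℝ} {s : ℝ}
    (hb : ∀ j, IsC1Homogeneous (b j) s) : ∫ θ, starD b (θ : E3) ∂sphereArea = 0 := by
  have hbx : ∀ j m, IsC1Homogeneous (fun x => b j x * x m) (s + 1) :=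
    fun j m => (hb j).mul (IsC1Homogeneous.coord m)
  -- The field is `W = b × x`. Its divergence is `x · curl b` because `curl x = 0`, and its flux
  -- vanishes because it is tangent to the sphere.
  have h := integral_divergence_eq_flux (s := s + 1)
    (W := ![fun x => b 1 x * x 2 - b 2 x * x 1, fun x => b 2 x * x 0 - b 0 x * x 2,
      fun x => b 0 x * x 1 - b 1 x * x 0])
    (by intro k; fin_cases k <;> exact (hbx _ _).sub (hbx _ _))
  have h1 : ∀ θ : Metric.sphere (0 : E3) 1, ∑ k, partialD k
      (![fun x => b 1 x * x 2 - b 2 x * x 1, fun x => b 2 x * x 0 - b 0 x * x 2,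
      fun x => b 0 x * x 1 - b 1 x * x 0] k) (θ : E3) = starD b (θ : E3) := by
    intro θ
    have hθ := ne_zero_of_mem_unitSphere θ
    have h2 : ∀ k j m j' m', partialD k (fun x => b j x * x m - b j' x * x m') (θ : E3)
        = partialD k (b j) θ * (θ : E3) m + b j θ * (if m = k then 1 else 0)
          - (partialD k (b j') θ * (θ : E3) m' + b j' θ * (if m' = k then 1 else 0)) := by
      intro k j m j' m'
      rw [partialD_sub ((hbx j m).differentiableAt hθ) ((hbx j' m').differentiableAt hθ),
        partialD_mul ((hb j).differentiableAt hθ) (differentiableAt_coord m _),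
        partialD_mul ((hb j').differentiableAt hθ) (differentiableAt_coord m' _),
        partialD_coord, partialD_coord]
    simp only [Fin.sum_univ_three, Matrix.cons_val_zero, Matrix.cons_val_one, Matrix.cons_val, h2,
      starD]
    simp
    ring
  have h3 : ∀ x : E3, ∑ k, x k *
      (![fun x => b 1 x * x 2 - b 2 x * x 1, fun x => b 2 x * x 0 - b 0 x * x 2,
      fun x => b 0 x * x 1 - b 1 x * x 0] k) x = 0 := by
    intro x
    simp only [Fin.sum_univ_three, Matrix.cons_val_zero, Matrix.cons_val_one, Matrix.cons_val]
    ring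
  simpa only [h1, h3, integral_zero, mul_zero] using h

/-- From `curl (xⁱ a) = xⁱ curl a + eᵢ × a` and `x · (eᵢ × a) = -a · (eᵢ × x) = -a · Y`. -/
theorem starD_coord_mul {a : Fin 3 → E3 → ℝ} {x : E3} (ha : ∀ j, DifferentiableAt ℝ (a j) x)
    (i : Fin 3) : starD (fun j y => y i * a j y) x
      = x i * starD a x - ∑ j, a j x * rotationField i x j := by
  simp only [starD, partialD_mul (differentiableAt_coord i x) (ha _), partialD_coord]
  fin_cases i <;>
    simp [Fin.sum_univ_three, rotationField_zero, rotationField_one, rotationField_two] <;> ring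

theorem continuousOn_starD {a : Fin 3 → E3 → ℝ} {s : ℝ} (ha : ∀ j, IsC1Homogeneous (a j) s) :
    ContinuousOn (starD a) {0}ᶜ := by
  have hc : ∀ m : Fin 3, ContinuousOn (fun x : E3 => x m) {0}ᶜ :=
    fun m => (IsC1Homogeneous.coord m).contDiffOn.continuousOn
  have hd : ∀ k j, ContinuousOn (partialD k (a j)) {0}ᶜ := fun k j => (ha j).continuousOn_partialD k
  exact (((hc 0).mul ((hd 1 2).sub (hd 2 1))).add ((hc 1).mul ((hd 2 0).sub (hd 0 2)))).add
    ((hc 2).mul ((hd 0 1).sub (hd 1 0)))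

theorem integral_coord_mul_starD_mixedPart {B : TensorField} (hB : IsC1OnSphere B) (i : Fin 3) :
    ∫ θ, (θ : E3) i * starD (mixedPart B) (θ : E3) ∂sphereArea
      = ∫ θ, angularIntegrand B i (θ : E3) ∂sphereArea := by
  have ha := isC1Homogeneous_mixedPart hB
  have h := integral_starD_eq_zero fun j => (IsC1Homogeneous.coord i).mul (ha j)
  have h1 : ∀ θ : Metric.sphere (0 : E3) 1, starD (fun j y => y i * mixedPart B j y) (θ : E3)
      = (θ : E3) i * starD (mixedPart B) (θ : E3) - angularIntegrand B i (θ : E3) := by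
    intro θ
    rw [starD_coord_mul fun j => (ha j).differentiableAt (ne_zero_of_mem_unitSphere θ)]
    congr 1
    simp only [mixedPart, angularIntegrand, norm_eq_of_mem_sphere θ, radialExt_coe_sphere,
      Finset.sum_mul]
    exact Finset.sum_congr rfl fun j _ => Finset.sum_congr rfl fun k _ => by ring
  simp only [h1] at h
  have hi : Integrable (fun θ : Metric.sphere (0 : E3) 1 =>
      (θ : E3) i * starD (mixedPart B) (θ : E3)) sphereArea :=
    (((IsC1Homogeneous.coord i).contDiffOn.continuousOn).mul
      (continuousOn_starD ha)).integrable_sphereArea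
  rw [integral_sub hi (integrable_angularIntegrand_sphere hB i)] at h
  linarith

/-! ### Decay of functions and their first derivatives -/

/-- `f = O(r^a)` at infinity. -/
abbrev DecaysAt {F : Type*} [Norm F] (f : E3 → F) (a : ℝ) : Prop :=
  f =O[Bornology.cobounded E3] fun x => ‖x‖ ^ a

theorem eventually_one_le_norm : ∀ᶠ x in Bornology.cobounded E3, 1 ≤ ‖x‖ :=
  eventually_cobounded_le_norm 1

theorem DecaysAt.mono {F : Type*} [Norm F] {f : E3 → F} {a b : ℝ} (hf : DecaysAt f a)
    (hab : a ≤ b) : DecaysAt f b := by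
  refine Asymptotics.IsBigO.trans hf (Asymptotics.IsBigO.of_bound' ?_)
  filter_upwards [eventually_one_le_norm] with x hx
  rw [Real.norm_of_nonneg (by positivity), Real.norm_of_nonneg (by positivity)]
  exact Real.rpow_le_rpow_of_exponent_le hx hab

theorem eventually_rpow_add (a b : ℝ) :
    (fun x : E3 => ‖x‖ ^ a * ‖x‖ ^ b) =ᶠ[Bornology.cobounded E3] fun x => ‖x‖ ^ (a + b) := by
  filter_upwards [eventually_one_le_norm] with x hx
  rw [Real.rpow_add (by linarith)]

theorem DecaysAt.mul {f g : E3 → ℝ} {a b c : ℝ} (hf : DecaysAt f a) (hg : DecaysAt g b)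
    (hc : a + b = c) : DecaysAt (fun x => f x * g x) c :=
  hc ▸ (Asymptotics.IsBigO.mul hf hg).trans_eventuallyEq (eventually_rpow_add a b)

theorem DecaysAt.smul {F : Type*} [NormedAddCommGroup F] [NormedSpace ℝ F] {f : E3 → ℝ}
    {g : E3 → F} {a b c : ℝ} (hf : DecaysAt f a) (hg : DecaysAt g b) (hc : a + b = c) :
    DecaysAt (fun x => f x • g x) c :=
  hc ▸ (Asymptotics.IsBigO.smul hf hg).trans_eventuallyEq (eventually_rpow_add a b)

theorem DecaysAt.tendsto_zero {f : E3 → ℝ} {a : ℝ} (hf : DecaysAt f a) (ha : a < 0) :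
    Tendsto f (Bornology.cobounded E3) (𝓝 0) := by
  refine hf.trans_tendsto ?_
  have := (tendsto_rpow_neg_atTop (neg_pos.2 ha)).comp (tendsto_norm_cobounded_atTop (E := E3))
  simpa [Function.comp_def] using this

/-- A property that holds near infinity holds near every point that is close to infinity. -/
theorem eventually_eventually_nhds_cobounded {P : E3 → Prop}
    (h : ∀ᶠ x in Bornology.cobounded E3, P x) :
    ∀ᶠ x in Bornology.cobounded E3, ∀ᶠ y in 𝓝 x, P y := by
  obtain ⟨r, -, hr⟩ := (Metric.hasBasis_cobounded_compl_closedBall (0 : E3)).eventually_iff.1 h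
  refine (Metric.hasBasis_cobounded_compl_closedBall (0 : E3)).eventually_iff.2
    ⟨r, trivial, fun x hx => ?_⟩
  filter_upwards [Metric.isClosed_closedBall.isOpen_compl.mem_nhds hx] with y hy using hr hy

/-- `f = O₁(r^a)`: near infinity `f` is differentiable, and `f = O(r^a)`, `df = O(r^(a - 1))`. -/
structure C1DecaysAt (f : E3 → ℝ) (a : ℝ) : Prop where
  differentiableAt : ∀ᶠ x in Bornology.cobounded E3, DifferentiableAt ℝ f x
  decaysAt : DecaysAt f a
  fderiv : DecaysAt (fderiv ℝ f) (a - 1)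

namespace C1DecaysAt

variable {f g : E3 → ℝ} {a b c : ℝ}

theorem mono (hf : C1DecaysAt f a) (hab : a ≤ b) : C1DecaysAt f b :=
  ⟨hf.1, hf.2.mono hab, hf.3.mono (by linarith)⟩

theorem congr (hf : C1DecaysAt f a) (h : f =ᶠ[Bornology.cobounded E3] g) : C1DecaysAt g a := by
  have h' := eventually_eventually_nhds_cobounded h
  refine ⟨?_, Asymptotics.IsBigO.congr' hf.2 h EventuallyEq.rfl, ?_⟩
  · filter_upwards [hf.1, h'] with x hx hx'
    exact hx.congr_of_eventuallyEq (EventuallyEq.symm hx')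
  · refine Asymptotics.IsBigO.congr' hf.3 ?_ EventuallyEq.rfl
    filter_upwards [h'] with x hx using EventuallyEq.fderiv_eq hx

theorem add (hf : C1DecaysAt f a) (hg : C1DecaysAt g a) : C1DecaysAt (fun x => f x + g x) a := by
  refine ⟨?_, Asymptotics.IsBigO.add hf.2 hg.2, ?_⟩
  · filter_upwards [hf.1, hg.1] with x hx hx' using hx.add hx'
  · refine (Asymptotics.IsBigO.add hf.3 hg.3).congr' ?_ EventuallyEq.rfl
    filter_upwards [hf.1, hg.1] with x hx hx' using (fderiv_fun_add hx hx').symm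

theorem mul (hf : C1DecaysAt f a) (hg : C1DecaysAt g b) (hc : a + b = c) :
    C1DecaysAt (fun x => f x * g x) c := by
  refine ⟨?_, hf.2.mul hg.2 hc, ?_⟩
  · filter_upwards [hf.1, hg.1] with x hx hx' using hx.mul hx'
  · refine ((hf.2.smul (c := c - 1) hg.3 (by linarith)).add
      (hg.2.smul (c := c - 1) hf.3 (by linarith))).congr' ?_ EventuallyEq.rfl
    filter_upwards [hf.1, hg.1] with x hx hx' using (fderiv_fun_mul hx hx').symm

theorem const (c : ℝ) : C1DecaysAt (fun _ => c) 0 := by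
  refine ⟨.of_forall fun x => differentiableAt_const c, ?_, ?_⟩
  · simp only [DecaysAt, Real.rpow_zero]
    exact Asymptotics.isBigO_const_const c (one_ne_zero (α := ℝ)) _
  · simpa using! Asymptotics.isBigO_zero _ _

theorem const_mul (hf : C1DecaysAt f a) (c : ℝ) : C1DecaysAt (fun x => c * f x) a :=
  (const c).mul hf (zero_add a)

theorem neg (hf : C1DecaysAt f a) : C1DecaysAt (fun x => -f x) a := by
  simpa using hf.const_mul (-1)

theorem sub (hf : C1DecaysAt f a) (hg : C1DecaysAt g a) : C1DecaysAt (fun x => f x - g x) a := by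
  simpa only [sub_eq_add_neg] using hf.add hg.neg

theorem zero (a : ℝ) : C1DecaysAt (fun _ => 0) a := by
  refine ⟨.of_forall fun x => differentiableAt_const _, Asymptotics.isBigO_zero _ _, ?_⟩
  simpa using! Asymptotics.isBigO_zero _ _

theorem sum {ι : Type*} {u : Finset ι} {F : ι → E3 → ℝ} (hF : ∀ i ∈ u, C1DecaysAt (F i) a) :
    C1DecaysAt (fun x => ∑ i ∈ u, F i x) a := by
  classical
  induction u using Finset.induction_on with
  | empty => simpa using zero a
  | insert i u hi ih =>
    simp only [Finset.sum_insert hi]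
    exact (hF i (Finset.mem_insert_self i u)).add
      (ih fun j hj => hF j (Finset.mem_insert_of_mem hj))

theorem decaysAt_partialD (hf : C1DecaysAt f a) (k : Fin 3) : DecaysAt (partialD k f) (a - 1) := by
  refine Asymptotics.IsBigO.trans (Asymptotics.IsBigO.of_bound ‖basisVec k‖ (.of_forall fun x => ?_))
    hf.3
  rw [mul_comm]
  exact (_root_.fderiv ℝ f x).le_opNorm _

/-- Functions that converge to a constant at rate `r^a`, with derivatives: product. -/
theorem mul_sub_const (ha : a ≤ 0) {c d : ℝ} (hf : C1DecaysAt (fun x => f x - c) a)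
    (hg : C1DecaysAt (fun x => g x - d) a) : C1DecaysAt (fun x => f x * g x - c * d) a := by
  have h1 := (hf.mul (hg.mono ha) (add_zero a)).add ((hf.const_mul d).add (hg.const_mul c))
  exact h1.congr (.of_forall fun x => by ring)

theorem of_sub_const (ha : a ≤ 0) {c : ℝ} (hf : C1DecaysAt (fun x => f x - c) a) :
    C1DecaysAt f 0 :=
  ((hf.mono ha).add (const c)).congr (.of_forall fun x => by ring)

theorem prod_sub_const {ι : Type*} (ha : a ≤ 0) (u : Finset ι) {F : ι → E3 → ℝ} {c : ι → ℝ}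
    (hF : ∀ i, C1DecaysAt (fun x => F i x - c i) a) :
    C1DecaysAt (fun x => ∏ i ∈ u, F i x - ∏ i ∈ u, c i) a := by
  classical
  induction u using Finset.induction_on with
  | empty => simpa using zero a
  | insert i u hi ih =>
    simp only [Finset.prod_insert hi]
    exact (hF i).mul_sub_const ha ih

theorem det_sub_const {n : Type*} [Fintype n] [DecidableEq n] (ha : a ≤ 0)
    {G : E3 → Matrix n n ℝ} {C : Matrix n n ℝ}
    (hG : ∀ i j, C1DecaysAt (fun x => G x i j - C i j) a) :
    C1DecaysAt (fun x => (G x).det - C.det) a := by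
  simp only [Matrix.det_apply', ← Finset.sum_sub_distrib, ← mul_sub]
  exact sum fun σ _ => (prod_sub_const ha _ fun i => hG (σ i) i).const_mul _

theorem inv_sub_one (ha : a < 0) (hf : C1DecaysAt (fun x => f x - 1) a) :
    C1DecaysAt (fun x => (f x)⁻¹ - 1) a := by
  have ht : Tendsto f (Bornology.cobounded E3) (𝓝 1) := by
    simpa using (hf.2.tendsto_zero ha).add_const 1
  have hne : ∀ᶠ x in Bornology.cobounded E3, f x ≠ 0 := ht.eventually_ne one_ne_zero
  have hd : ∀ᶠ x in Bornology.cobounded E3, DifferentiableAt ℝ f x := by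
    filter_upwards [hf.1] with x hx
    simpa using hx.add_const 1
  have hinv : DecaysAt (fun x => (f x)⁻¹) 0 := by
    simp only [DecaysAt, Real.rpow_zero]
    exact (ht.inv₀ one_ne_zero).isBigO_one ℝ
  refine ⟨?_, ?_, ?_⟩
  · filter_upwards [hd, hne] with x hx hx' using (hx.inv hx').sub_const 1
  · refine (hinv.mul hf.neg.2 (zero_add a)).congr' ?_ EventuallyEq.rfl
    filter_upwards [hne] with x hx
    field_simp
    ring
  · have h1 : DecaysAt (fun x => (-((f x)⁻¹ * (f x)⁻¹)) • _root_.fderiv ℝ (fun x => f x - 1) x) (a - 1) :=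
      DecaysAt.smul (hinv.mul hinv (add_zero 0)).neg_left hf.3 (by ring)
    refine Asymptotics.IsBigO.congr' h1 ?_ EventuallyEq.rfl
    filter_upwards [hd, hne] with x hx hx'
    have h2 := (hasDerivAt_inv hx').comp_hasFDerivAt x hx.hasFDerivAt
    have h3 : HasFDerivAt (fun x => (f x)⁻¹ - 1) (-(f x ^ 2)⁻¹ • _root_.fderiv ℝ f x) x := h2.sub_const 1
    rw [h3.fderiv, fderiv_sub_const]
    congr 1
    rw [pow_two, mul_inv]

/-- By Cramer's rule the inverse is `det⁻¹` times the adjugate, and both factors converge at rate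
`r^a`, with first derivatives, to their values at the identity. -/
theorem matrix_inv_sub_one {n : Type*} [Fintype n] [DecidableEq n] (ha : a < 0)
    {G : E3 → Matrix n n ℝ}
    (hG : ∀ i j, C1DecaysAt (fun x => G x i j - (1 : Matrix n n ℝ) i j) a) (i j : n) :
    C1DecaysAt (fun x => (G x)⁻¹ i j - (1 : Matrix n n ℝ) i j) a := by
  have hdet : C1DecaysAt (fun x => ((G x).det)⁻¹ - 1) a :=
    inv_sub_one ha (by simpa using det_sub_const ha.le hG)
  have hadj : C1DecaysAt (fun x => (G x).adjugate i j - (1 : Matrix n n ℝ).adjugate i j) a := by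
    simp only [Matrix.adjugate_apply]
    refine det_sub_const ha.le fun k l => ?_
    -- An adjugate entry is the determinant with row `j` replaced by a basis vector: that row is
    -- constant, and the others are rows of `G`.
    by_cases hk : k = j
    · subst hk
      simpa using zero a
    · simpa [Matrix.updateRow_ne hk] using hG k l
  have h := hdet.mul_sub_const ha.le hadj
  simpa [Matrix.inv_def, Ring.inverse_eq_inv'] using h

theorem of_isBigOOrder {n : ℕ} (hn : 1 ≤ n) (hf : IsBigOOrder n f a) : C1DecaysAt f a := by
  obtain ⟨⟨R, hR⟩, h⟩ := hf
  refine ⟨?_, ?_, ?_⟩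
  · filter_upwards [eventually_cobounded_le_norm (E := E3) (R + 1)] with x hx
    have hx' : R < ‖x‖ := by linarith
    exact (hR.contDiffAt ((isOpen_lt continuous_const continuous_norm).mem_nhds hx')).differentiableAt
      (by simp; omega)
  · have h0 := (h 0 (Nat.zero_le n)).norm_left
    simpa [norm_iteratedFDeriv_zero] using h0
  · have h1 := (h 1 hn).norm_left
    simp only [norm_iteratedFDeriv_one, Nat.cast_one] at h1
    exact h1.of_norm_left

end C1DecaysAt

theorem IsLittleOOrder.isBigOOrder {n : ℕ} {f : E3 → ℝ} {a : ℝ} (hf : IsLittleOOrder n f a) :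
    IsBigOOrder n f a :=
  ⟨hf.1, fun m hm => (hf.2 m hm).isBigO⟩

/-- Rescale to the compact unit sphere, where `f` is bounded. Values in a normed space allow the
same bound for the derivative. -/
theorem IsC1Homogeneous.decaysAt {F : Type*} [NormedAddCommGroup F] [NormedSpace ℝ F]
    {f : E3 → F} {s : ℝ} (hc : ContinuousOn f {0}ᶜ)
    (hf : ∀ t : ℝ, 0 < t → ∀ x : E3, x ≠ 0 → f (t • x) = t ^ s • f x) : DecaysAt f s := by
  obtain ⟨C, hC⟩ := (isCompact_sphere (0 : E3) 1).exists_bound_of_continuousOn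
    (hc.mono fun x hx => ne_zero_of_mem_unit_sphere ⟨x, hx⟩)
  refine Asymptotics.IsBigO.of_bound C ?_
  filter_upwards [eventually_one_le_norm] with x hx
  have hx0 : 0 < ‖x‖ := by linarith
  have hxne : x ≠ 0 := norm_pos_iff.1 hx0
  have h1 : ‖‖x‖⁻¹ • x‖ = 1 := by
    rw [norm_smul, norm_inv, norm_norm, inv_mul_cancel₀ hx0.ne']
  have h2 := hf ‖x‖ hx0 (‖x‖⁻¹ • x) (smul_ne_zero (inv_ne_zero hx0.ne') hxne)
  rw [smul_inv_smul₀ hx0.ne'] at h2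
  rw [h2, norm_smul, mul_comm]
  gcongr
  exact hC _ (by simpa using h1)

theorem IsC1Homogeneous.c1DecaysAt {f : E3 → ℝ} {s : ℝ} (hf : IsC1Homogeneous f s) :
    C1DecaysAt f s := by
  refine ⟨?_, IsC1Homogeneous.decaysAt hf.contDiffOn.continuousOn hf.map_smul,
    IsC1Homogeneous.decaysAt hf.continuousOn_fderiv fun t ht x hx => hf.fderiv_smul ht hx⟩
  filter_upwards [eventually_one_le_norm] with x hx
  exact hf.differentiableAt (norm_pos_iff.1 (by linarith))

/-- A homogeneous function of degree `s` that decays faster than `r^s` vanishes. -/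
theorem eq_zero_of_homogeneous_of_decaysAt {f : E3 → ℝ} {s b : ℝ} {x : E3} (hx : x ≠ 0)
    (hf : ∀ t : ℝ, 0 < t → f (t • x) = t ^ s * f x) (hd : DecaysAt f b) (hb : b < s) :
    f x = 0 := by
  have ht : Tendsto (fun t : ℝ => t • x) atTop (Bornology.cobounded E3) := by
    rw [← tendsto_norm_atTop_iff_cobounded]
    have : Tendsto (fun t : ℝ => |t| * ‖x‖) atTop atTop :=
      tendsto_abs_atTop_atTop.atTop_mul_const (norm_pos_iff.2 hx)
    simpa [norm_smul] using this
  -- This function is constant along the ray through `x` and tends to zero at infinity.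
  have h1 : DecaysAt (fun y => ‖y‖ ^ (-s) * f y) (-s + b) :=
    DecaysAt.mul (Asymptotics.isBigO_refl _ _) hd rfl
  have h2 := (h1.tendsto_zero (by linarith)).comp ht
  have h3 : Tendsto (fun _ : ℝ => ‖x‖ ^ (-s) * f x) atTop (𝓝 0) := by
    refine h2.congr' ?_
    filter_upwards [eventually_gt_atTop 0] with t htpos
    simp only [Function.comp]
    rw [hf t htpos, norm_smul, Real.norm_of_nonneg htpos.le, Real.mul_rpow htpos.le (norm_nonneg x),
      Real.rpow_neg htpos.le]
    have : t ^ s ≠ 0 := (Real.rpow_pos_of_pos htpos s).ne'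
    field_simp
  have h4 := tendsto_nhds_unique tendsto_const_nhds h3
  exact (mul_eq_zero.1 h4).resolve_left (Real.rpow_pos_of_pos (norm_pos_iff.2 hx) _).ne'

/-! ### The momentum constraint near infinity -/

/-- The perturbation of the identity costs at most half of `|v|²`: each of the nine entries costs at
most `(vᵢ² + vⱼ²) / 12`. This bounds the components of the current density by its `g`-length. -/
theorem sq_le_of_near_one {H : Matrix (Fin 3) (Fin 3) ℝ}
    (hH : ∀ i j, |H i j - (1 : Matrix (Fin 3) (Fin 3) ℝ) i j| ≤ 1 / 6) (v : Fin 3 → ℝ) (k : Fin 3) :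
    v k ^ 2 ≤ 2 * ∑ i, ∑ j, H i j * v i * v j := by
  have h1 : ∀ i j, -(1 / 12 * (v i ^ 2 + v j ^ 2))
      ≤ (H i j - (1 : Matrix (Fin 3) (Fin 3) ℝ) i j) * (v i * v j) := by
    intro i j
    have h2 : |(H i j - (1 : Matrix (Fin 3) (Fin 3) ℝ) i j) * (v i * v j)|
        ≤ 1 / 6 * (1 / 2 * (v i ^ 2 + v j ^ 2)) := by
      rw [abs_mul]
      refine mul_le_mul (hH i j) ?_ (abs_nonneg _) (by norm_num)
      rw [abs_le]
      constructor <;> nlinarith [sq_nonneg (v i + v j), sq_nonneg (v i - v j)]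
    linarith [(abs_le.1 h2).1]
  have h3 : ∑ i, ∑ j, H i j * v i * v j
      = ∑ i, v i ^ 2 + ∑ i, ∑ j, (H i j - (1 : Matrix (Fin 3) (Fin 3) ℝ) i j) * (v i * v j) := by
    simp [Fin.sum_univ_three, Matrix.one_apply]
    ring
  have h4 : ∑ i, ∑ j, -(1 / 12 * (v i ^ 2 + v j ^ 2))
      ≤ ∑ i, ∑ j, (H i j - (1 : Matrix (Fin 3) (Fin 3) ℝ) i j) * (v i * v j) :=
    Finset.sum_le_sum fun i _ => Finset.sum_le_sum fun j _ => h1 i j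
  have h5 : v k ^ 2 ≤ ∑ i, v i ^ 2 :=
    Finset.single_le_sum (f := fun i => v i ^ 2) (fun i _ => sq_nonneg _) (Finset.mem_univ k)
  have h6 : ∑ i, ∑ j, -(1 / 12 * (v i ^ 2 + v j ^ 2)) = -(1 / 2) * ∑ i, v i ^ 2 := by
    simp only [Fin.sum_univ_three]
    ring
  linarith

section Constraint

variable {g k : TensorField} {p q : ℝ}

theorem decaysAt_currentDensity (hq : 0 < q)
    (hg : ∀ i j, C1DecaysAt (fun x => g x i j - (1 : Matrix (Fin 3) (Fin 3) ℝ) i j) (-q))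
    {b : ℝ} (hJ : DecaysAt (currentLength g k) b) (j : Fin 3) :
    DecaysAt (currentDensity g k j) b := by
  refine Asymptotics.IsBigO.trans (Asymptotics.IsBigO.of_bound 2 ?_) hJ
  have h1 : ∀ᶠ x in Bornology.cobounded E3, ∀ i j,
      |(g x)⁻¹ i j - (1 : Matrix (Fin 3) (Fin 3) ℝ) i j| ≤ 1 / 6 := by
    refine eventually_all.2 fun i => eventually_all.2 fun j => ?_
    have h2 := (C1DecaysAt.matrix_inv_sub_one (neg_lt_zero.2 hq) hg i j).2.tendsto_zero
      (neg_lt_zero.2 hq)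
    have h3 : ∀ᶠ x in Bornology.cobounded E3,
        |(g x)⁻¹ i j - (1 : Matrix (Fin 3) (Fin 3) ℝ) i j| < 1 / 6 := by
      have h4 := h2.abs
      rw [abs_zero] at h4
      exact h4.eventually_lt_const (by norm_num)
    exact h3.mono fun x hx => hx.le
  filter_upwards [h1] with x hx
  have h2 := sq_le_of_near_one hx (fun i => currentDensity g k i x) j
  rw [Real.norm_eq_abs, currentLength, Real.norm_of_nonneg (Real.sqrt_nonneg _)]
  have h3 := Real.abs_le_sqrt (h2.trans (show _ ≤ 2 ^ 2 * ∑ i, ∑ j, (g x)⁻¹ i j *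
    currentDensity g k i x * currentDensity g k j x by nlinarith [sq_nonneg (currentDensity g k j x)]))
  rwa [Real.sqrt_mul (by norm_num), Real.sqrt_sq (by norm_num)] at h3

theorem decaysAt_partialD_metric
    (hg : ∀ i j, C1DecaysAt (fun x => g x i j - (1 : Matrix (Fin 3) (Fin 3) ℝ) i j) (-q))
    (l i j : Fin 3) : DecaysAt (partialD l fun x => g x i j) (-q - 1) := by
  have h := (hg i j).decaysAt_partialD l
  have h2 : partialD l (fun x => g x i j - (1 : Matrix (Fin 3) (Fin 3) ℝ) i j)
      = partialD l fun x => g x i j := by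
    funext x
    simp only [partialD, fderiv_sub_const]
  rwa [h2] at h

theorem decaysAt_christoffel (hq : 0 < q)
    (hg : ∀ i j, C1DecaysAt (fun x => g x i j - (1 : Matrix (Fin 3) (Fin 3) ℝ) i j) (-q))
    (m i j : Fin 3) : DecaysAt (christoffel g m i j) (-q - 1) := by
  have hq' := neg_lt_zero.2 hq
  unfold christoffel
  refine Asymptotics.IsBigO.const_mul_left (Asymptotics.IsBigO.fun_sum fun l _ => ?_) _
  exact ((C1DecaysAt.matrix_inv_sub_one hq' hg m l).of_sub_const hq'.le).2.mul
    (((decaysAt_partialD_metric hg i j l).add (decaysAt_partialD_metric hg j i l)).sub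
      (decaysAt_partialD_metric hg l i j)) (by ring)

/-- The difference consists of `(g⁻¹ - δ) ∂k` and `g⁻¹ Γ k`; in each, the metric factor gains
`r^(-q)` over the size `r^(-p-1)` of `∂k`. -/
theorem decaysAt_divergenceWrt_sub (hq : 0 < q)
    (hg : ∀ i j, C1DecaysAt (fun x => g x i j - (1 : Matrix (Fin 3) (Fin 3) ℝ) i j) (-q))
    (hk : ∀ i j, C1DecaysAt (fun x => k x i j) (-p)) (j : Fin 3) :
    DecaysAt (fun x => divergenceWrt g k j x - ∑ l, partialD l (fun y => k y l j) x)
      (-p - q - 1) := by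
  have hq' := neg_lt_zero.2 hq
  have h1 : ∀ x, divergenceWrt g k j x - ∑ l, partialD l (fun y => k y l j) x
      = ∑ l, ∑ i, (((g x)⁻¹ l i - (1 : Matrix (Fin 3) (Fin 3) ℝ) l i)
          * partialD l (fun y => k y i j) x
        - (g x)⁻¹ l i * ∑ m, (christoffel g m l i x * k x m j
          + christoffel g m l j x * k x i m)) := by
    intro x
    have h2 : ∀ l, partialD l (fun y => k y l j) x
        = ∑ i, (1 : Matrix (Fin 3) (Fin 3) ℝ) l i * partialD l (fun y => k y i j) x := by
      intro l
      simp [Matrix.one_apply]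
    simp only [h2, divergenceWrt, covDeriv, ← Finset.sum_sub_distrib]
    exact Finset.sum_congr rfl fun l _ => Finset.sum_congr rfl fun i _ => by ring
  simp only [h1]
  refine Asymptotics.IsBigO.fun_sum fun l _ => Asymptotics.IsBigO.fun_sum fun i _ => ?_
  have hi := C1DecaysAt.matrix_inv_sub_one hq' hg l i
  refine Asymptotics.IsBigO.sub (hi.2.mul ((hk i j).decaysAt_partialD l) (by ring)) ?_
  refine (hi.of_sub_const hq'.le).2.mul (b := -p - q - 1)
    (Asymptotics.IsBigO.fun_sum fun m _ => ?_) (by ring)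
  exact ((decaysAt_christoffel hq hg m l i).mul (hk m j).2 (by ring)).add
    ((decaysAt_christoffel hq hg m l j).mul (hk i m).2 (by ring))

theorem traceWrt_conjugateMomentum {x : E3} (hdet : (g x).det ≠ 0)
    (hsymm : ∀ i j, g x i j = g x j i) :
    traceWrt g (conjugateMomentum g k) x = -2 * traceWrt g k x := by
  have h1 : ∑ i, ∑ j, (g x)⁻¹ i j * g x i j = 3 := by
    have h2 := Matrix.nonsing_inv_mul (g x) (isUnit_iff_ne_zero.2 hdet)
    have h3 : ∀ i, ∑ j, (g x)⁻¹ i j * g x i j = 1 := by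
      intro i
      have h4 := congrFun (congrFun h2 i) i
      rw [Matrix.mul_apply, Matrix.one_apply_eq] at h4
      rw [← h4]
      exact Finset.sum_congr rfl fun j _ => by rw [hsymm i j]
    simp [h3]
  have h5 : traceWrt g (conjugateMomentum g k) x
      = traceWrt g k x - traceWrt g k x * ∑ i, ∑ j, (g x)⁻¹ i j * g x i j := by
    conv_lhs => unfold traceWrt
    conv_rhs => enter [1]; unfold traceWrt
    simp only [conjugateMomentum, Finset.mul_sum, ← Finset.sum_sub_distrib, Matrix.sub_apply,
      Matrix.smul_apply, smul_eq_mul]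
    exact Finset.sum_congr rfl fun i _ => Finset.sum_congr rfl fun j _ => by ring
  rw [h5, h1]
  ring

/-- In dimension three `tr π = -2 tr k`, so the decay of `π` at rate `-p` passes to `tr k`, and then
to `k = π + (tr k) g`. This gives `k` the rate of the expansion. -/
theorem c1DecaysAt_traceWrt (hq : 0 < q)
    (hg : ∀ i j, C1DecaysAt (fun x => g x i j - (1 : Matrix (Fin 3) (Fin 3) ℝ) i j) (-q))
    (hsymm : ∀ x i j, g x i j = g x j i)
    (hπ : ∀ i j, C1DecaysAt (fun x => conjugateMomentum g k x i j) (-p)) :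
    C1DecaysAt (traceWrt g k) (-p) := by
  have hq' := neg_lt_zero.2 hq
  have h1 : C1DecaysAt (traceWrt g (conjugateMomentum g k)) (-p) :=
    C1DecaysAt.sum fun i _ => C1DecaysAt.sum fun j _ =>
      ((C1DecaysAt.matrix_inv_sub_one hq' hg i j).of_sub_const hq'.le).mul (hπ i j) (zero_add _)
  have hdet : ∀ᶠ x in Bornology.cobounded E3, (g x).det ≠ 0 := by
    have h2 := ((C1DecaysAt.det_sub_const hq'.le hg).2.tendsto_zero hq').add_const
      (1 : Matrix (Fin 3) (Fin 3) ℝ).det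
    simp only [sub_add_cancel, zero_add, Matrix.det_one] at h2
    exact h2.eventually_ne one_ne_zero
  refine (h1.const_mul (-(1 / 2))).congr ?_
  filter_upwards [hdet] with x hx
  rw [traceWrt_conjugateMomentum hx (hsymm x)]
  ring

/-- The Euclidean divergence of the conjugate momentum agrees with the current density up to
quadratic terms. -/
theorem decaysAt_divergence_conjugateMomentum_sub (hq : 0 < q)
    (hg : ∀ i j, C1DecaysAt (fun x => g x i j - (1 : Matrix (Fin 3) (Fin 3) ℝ) i j) (-q))
    (hsymm : ∀ x i j, g x i j = g x j i)
    (hπ : ∀ i j, C1DecaysAt (fun x => conjugateMomentum g k x i j) (-p)) (j : Fin 3) :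
    DecaysAt (fun x => ∑ l, partialD l (fun y => conjugateMomentum g k y l j) x
      - currentDensity g k j x) (-p - q - 1) := by
  have hq' := neg_lt_zero.2 hq
  have hτ := c1DecaysAt_traceWrt hq hg hsymm hπ
  have hg0 : ∀ i j, C1DecaysAt (fun x => g x i j) 0 := fun i j => (hg i j).of_sub_const hq'.le
  have hk : ∀ i j, C1DecaysAt (fun x => k x i j) (-p) := by
    intro i j
    refine ((hπ i j).add (hτ.mul (hg0 i j) (add_zero _))).congr (.of_forall fun x => ?_)
    simp [conjugateMomentum]
  -- The term `d (tr k)` in the current density cancels the part of `∂ₗ((tr k) gₗⱼ)` in which `g` is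
  -- replaced by `δ`; only quadratic terms remain.
  have h1 : DecaysAt (fun x => -(divergenceWrt g k j x - ∑ l, partialD l (fun y => k y l j) x)
      - ∑ l, (partialD l (traceWrt g k) x * (g x l j - (1 : Matrix (Fin 3) (Fin 3) ℝ) l j)
        + traceWrt g k x * partialD l (fun y => g y l j) x)) (-p - q - 1) := by
    refine (decaysAt_divergenceWrt_sub hq hg hk j).neg_left.sub
      (Asymptotics.IsBigO.fun_sum fun l _ => ?_)
    exact ((hτ.decaysAt_partialD l).mul (hg l j).2 (by ring)).add
      (hτ.2.mul (decaysAt_partialD_metric hg l l j) (by ring))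
  refine Asymptotics.IsBigO.congr' h1 ?_ EventuallyEq.rfl
  have hkd : ∀ᶠ x in Bornology.cobounded E3, ∀ l, DifferentiableAt ℝ (fun y => k y l j) x :=
    eventually_all.2 fun l => (hk l j).1
  have hgd : ∀ᶠ x in Bornology.cobounded E3, ∀ l, DifferentiableAt ℝ (fun y => g y l j) x :=
    eventually_all.2 fun l => (hg0 l j).1
  filter_upwards [hkd, hgd, hτ.1] with x hkx hgx hτx
  have h2 : ∀ l, partialD l (fun y => conjugateMomentum g k y l j) x
      = partialD l (fun y => k y l j) x - (partialD l (traceWrt g k) x * g x l j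
        + traceWrt g k x * partialD l (fun y => g y l j) x) := by
    intro l
    simp only [conjugateMomentum, Matrix.sub_apply, Matrix.smul_apply, smul_eq_mul]
    rw [partialD_sub (g := fun y => traceWrt g k y * g y l j) (hkx l) (hτx.mul (hgx l)),
      partialD_mul hτx (hgx l)]
  have h3 : partialD j (traceWrt g k) x
      = ∑ l, partialD l (traceWrt g k) x * (1 : Matrix (Fin 3) (Fin 3) ℝ) l j := by
    simp [Matrix.one_apply]
  simp only [h2, currentDensity, h3, mul_sub, Finset.sum_sub_distrib, Finset.sum_add_distrib]
  ring

end Constraint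

/-! ### The leading term of the momentum -/

section Leading

variable {g k A B : TensorField} {p q b : ℝ}

theorem HasMomentumExpansion.c1DecaysAt_sub {π : TensorField} (hB : IsC1OnSphere B)
    (hπ : HasMomentumExpansion π A B p) (i j : Fin 3) :
    C1DecaysAt (fun x => π x i j - radialExt A x i j * ‖x‖ ^ (-p)) (-3) := by
  have h1 := C1DecaysAt.of_isBigOOrder le_rfl (hπ i j).isBigOOrder
  have h2 := (((isC1Homogeneous_radialExt hB i j).mul
    (IsC1Homogeneous.norm_rpow (-3))).congr_degree (zero_add _)).c1DecaysAt
  exact (h1.add h2).congr (.of_forall fun x => by ring)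

theorem isC1Homogeneous_radialExt_mul_rpow (hA : IsC1OnSphere A) (p : ℝ) (i j : Fin 3) :
    IsC1Homogeneous (fun x => radialExt A x i j * ‖x‖ ^ (-p)) (-p) :=
  ((isC1Homogeneous_radialExt hA i j).mul (IsC1Homogeneous.norm_rpow _)).congr_degree (zero_add _)

/-- The antisymmetric part of the leading term is homogeneous of degree `-p`, but by symmetry of `π`
it is `O(r^(-3))`; since `p < 3`, it vanishes. -/
theorem HasMomentumExpansion.radialExt_symm {π : TensorField} (hA : IsC1OnSphere A)
    (hB : IsC1OnSphere B) (hp : p < 3) (hπ : HasMomentumExpansion π A B p)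
    (hsymm : ∀ x i j, π x i j = π x j i) {x : E3} (hx : x ≠ 0) (i j : Fin 3) :
    radialExt A x i j = radialExt A x j i := by
  have hP := isC1Homogeneous_radialExt_mul_rpow hA p
  have h1 : DecaysAt (fun x => radialExt A x i j * ‖x‖ ^ (-p) - radialExt A x j i * ‖x‖ ^ (-p))
      (-3) := by
    refine ((hπ.c1DecaysAt_sub hB j i).sub (hπ.c1DecaysAt_sub hB i j)).2.congr_left fun x => ?_
    rw [hsymm x i j]
    ring
  have h2 := eq_zero_of_homogeneous_of_decaysAt hx
    (fun t ht => ((hP i j).sub (hP j i)).map_smul t ht x hx) h1 (by linarith)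
  rw [← sub_mul] at h2
  linarith [(mul_eq_zero.1 h2).resolve_right (Real.rpow_pos_of_pos (norm_pos_iff.2 hx) _).ne']

theorem HasMomentumExpansion.divergence_leading_eq_zero (hq : 0 < q)
    (hg : ∀ i j, C1DecaysAt (fun x => g x i j - (1 : Matrix (Fin 3) (Fin 3) ℝ) i j) (-q))
    (hgsymm : ∀ x i j, g x i j = g x j i) (hksymm : ∀ x i j, k x i j = k x j i)
    (hA : IsC1OnSphere A) (hB : IsC1OnSphere B) (hp : p < 3)
    (hπ : HasMomentumExpansion (conjugateMomentum g k) A B p)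
    (hJ : DecaysAt (currentLength g k) b) (hb : b ≤ -4) {x : E3} (hx : x ≠ 0) (j : Fin 3) :
    ∑ l, partialD l (fun y => radialExt A y j l * ‖y‖ ^ (-p)) x = 0 := by
  have hP := isC1Homogeneous_radialExt_mul_rpow hA p
  have hQ := hπ.c1DecaysAt_sub hB
  have hπsymm : ∀ i j, (fun x => conjugateMomentum g k x i j)
      = fun x => conjugateMomentum g k x j i := by
    intro i j
    funext x
    simp only [conjugateMomentum, Matrix.sub_apply, Matrix.smul_apply, hksymm x i j, hgsymm x i j]
  have hπd : ∀ i j, C1DecaysAt (fun x => conjugateMomentum g k x i j) (-p) := fun i j =>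
    (((hQ i j).mono (by linarith)).add (hP i j).c1DecaysAt).congr (.of_forall fun x => by ring)
  -- The exponent `-p - q - 1` comes from the quadratic error, and `-4` from the current density and
  -- the divergence of the `O₁(r^(-3))` part. Both lie below `-p - 1`, by `q > 0` and `p < 3`.
  have h1 : DecaysAt (fun x => ∑ l, partialD l (fun y => radialExt A y j l * ‖y‖ ^ (-p)) x)
      (max (-p - q - 1) (-4)) := by
    have h2 := (decaysAt_divergence_conjugateMomentum_sub hq hg hgsymm hπd j).mono
      (le_max_left _ (-4 : ℝ))
    have h3 := (decaysAt_currentDensity hq hg hJ j).mono (hb.trans (le_max_right (-p - q - 1) _))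
    have h4 : DecaysAt (fun x => ∑ l, partialD l (fun y => conjugateMomentum g k y j l
        - radialExt A y j l * ‖y‖ ^ (-p)) x) (max (-p - q - 1) (-4)) :=
      Asymptotics.IsBigO.fun_sum fun l _ => ((hQ j l).decaysAt_partialD l).mono
        ((by norm_num : (-3 - 1 : ℝ) ≤ -4).trans (le_max_right _ _))
    refine ((h2.add h3).sub h4).congr' ?_ EventuallyEq.rfl
    have hd : ∀ᶠ x in Bornology.cobounded E3, ∀ l,
        DifferentiableAt ℝ (fun y => conjugateMomentum g k y j l) x :=
      eventually_all.2 fun l => (hπd j l).1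
    filter_upwards [hd, eventually_one_le_norm] with x hdx hx
    have hx0 : x ≠ 0 := norm_pos_iff.1 (by linarith)
    rw [sub_add_cancel, ← Finset.sum_sub_distrib]
    refine Finset.sum_congr rfl fun l _ => ?_
    rw [partialD_sub (hdx l) ((hP j l).differentiableAt hx0), hπsymm l j]
    ring
  refine eq_zero_of_homogeneous_of_decaysAt (s := -p - 1) hx (fun t ht => ?_) h1
    (max_lt (by linarith) (by linarith))
  rw [Finset.mul_sum]
  refine Finset.sum_congr rfl fun l _ => ?_
  simp only [partialD]
  rw [(hP j l).fderiv_smul ht hx, _root_.smul_apply, smul_eq_mul]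

end Leading

/-! ### The limit of the angular momentum flux -/

theorem isC1Homogeneous_coord_div_norm (k : Fin 3) :
    IsC1Homogeneous (fun x : E3 => x k / ‖x‖) 0 := by
  simpa only [div_eq_mul_inv, Real.rpow_neg_one, add_neg_cancel] using
    (IsC1Homogeneous.coord k).mul (IsC1Homogeneous.norm_rpow (-1))

theorem isLittleO_angularIntegrand {E : TensorField}
    (hE : ∀ i j, (fun x => E x i j) =o[Bornology.cobounded E3] fun x => ‖x‖ ^ (-3 : ℝ))
    (i : Fin 3) :
    angularIntegrand E i =o[Bornology.cobounded E3] fun x => ‖x‖ ^ (-2 : ℝ) := by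
  refine Asymptotics.IsLittleO.fun_sum fun j _ => Asymptotics.IsLittleO.fun_sum fun k _ => ?_
  have h := ((hE j k).mul_isBigO (isC1Homogeneous_rotationField i j).c1DecaysAt.2).mul_isBigO
    (isC1Homogeneous_coord_div_norm k).c1DecaysAt.2
  refine h.congr' EventuallyEq.rfl ?_
  filter_upwards [eventually_one_le_norm] with x hx
  have hx0 : 0 < ‖x‖ := by linarith
  rw [← Real.rpow_add hx0, ← Real.rpow_add hx0]
  norm_num

theorem tendsto_flux_zero_of_isLittleO {G : E3 → ℝ}
    (hG : G =o[Bornology.cobounded E3] fun x => ‖x‖ ^ (-2 : ℝ)) :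
    Tendsto (fun r : ℝ => r ^ 2 * ∫ θ : Metric.sphere (0 : E3) 1, G (r • (θ : E3)) ∂sphereArea)
      atTop (𝓝 0) := by
  rw [Metric.tendsto_nhds]
  intro ε hε
  set m : ℝ := sphereArea.real univ
  have hm : 0 ≤ m := measureReal_nonneg
  -- With `m` the total area, `m + 1` keeps the denominator positive and makes the final bound
  -- strictly less than `ε`.
  have h1 := hG.bound (show 0 < ε / (m + 1) by positivity)
  obtain ⟨R, -, hR⟩ := (hasBasis_cobounded_norm (E := E3)).eventually_iff.1 h1
  filter_upwards [eventually_ge_atTop R, eventually_gt_atTop 0] with r hr hr0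
  have h2 : ∀ θ : Metric.sphere (0 : E3) 1, ‖G (r • (θ : E3))‖ ≤ ε / (m + 1) * r ^ (-2 : ℝ) := by
    intro θ
    have hn : ‖r • (θ : E3)‖ = r := by
      rw [norm_smul, norm_eq_of_mem_sphere θ, mul_one, Real.norm_of_nonneg hr0.le]
    have h3 := hR (show R ≤ ‖r • (θ : E3)‖ by rwa [hn])
    rwa [hn, Real.norm_of_nonneg (Real.rpow_nonneg hr0.le _)] at h3
  have h4 := norm_integral_le_of_norm_le_const (μ := sphereArea) (ae_of_all _ h2)
  rw [dist_zero_right, norm_mul, Real.norm_of_nonneg (sq_nonneg r)]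
  have h5 : r ^ 2 * r ^ (-2 : ℝ) = 1 := by
    rw [Real.rpow_neg hr0.le, show (2 : ℝ) = ((2 : ℕ) : ℝ) by norm_num, Real.rpow_natCast]
    field_simp
  calc r ^ 2 * ‖∫ θ : Metric.sphere (0 : E3) 1, G (r • (θ : E3)) ∂sphereArea‖
      ≤ r ^ 2 * (ε / (m + 1) * r ^ (-2 : ℝ) * m) := by gcongr
    _ = ε * (m / (m + 1)) * (r ^ 2 * r ^ (-2 : ℝ)) := by ring
    _ = ε * (m / (m + 1)) := by rw [h5, mul_one]
    _ < ε := by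
      refine mul_lt_of_lt_one_right hε ?_
      rw [div_lt_one (by linarith)]
      linarith

theorem integrable_angularIntegrand_smul {E : TensorField} {R : ℝ} (hR : 0 ≤ R)
    (hE : ∀ i j, ContinuousOn (fun x => E x i j) {x | R < ‖x‖}) (i : Fin 3) {r : ℝ} (hr : R < r) :
    Integrable (fun θ : Metric.sphere (0 : E3) 1 => angularIntegrand E i (r • (θ : E3)))
      sphereArea := by
  have hsub : {x : E3 | R < ‖x‖} ⊆ {0}ᶜ := fun x hx => norm_pos_iff.1 (hR.trans_lt hx)
  have h1 : ContinuousOn (angularIntegrand E i) {x | R < ‖x‖} :=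
    continuousOn_finsetSum _ fun j _ => continuousOn_finsetSum _ fun k _ =>
      ((hE j k).mul ((isC1Homogeneous_rotationField i j).contDiffOn.continuousOn.mono hsub)).mul
        ((isC1Homogeneous_coord_div_norm k).contDiffOn.continuousOn.mono hsub)
  have h2 : Continuous fun θ : Metric.sphere (0 : E3) 1 => angularIntegrand E i (r • (θ : E3)) := by
    refine h1.comp_continuous (continuous_subtype_val.const_smul r) fun θ => ?_
    have h0 : 0 < r := hR.trans_lt hr
    simpa [norm_smul, norm_eq_of_mem_sphere θ, abs_of_pos h0] using hr
  exact h2.integrable_of_hasCompactSupport (HasCompactSupport.of_compactSpace _)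

/-- The rotation field contributes one power of `r` and the unit normal none, so `r^(-p)` and
`r^(-3)` become `r^(1-p)` and `r^(-2)`; the latter is cancelled by the area factor `r²`. -/
theorem angularIntegrand_smul_coe_sphere {π A B : TensorField} {p : ℝ} (i : Fin 3) {r : ℝ}
    (hr : 0 < r) (θ : Metric.sphere (0 : E3) 1) :
    angularIntegrand π i (r • (θ : E3))
      = r ^ (1 - p) * angularIntegrand A i θ + r ^ (-2 : ℝ) * angularIntegrand B i θ
        + angularIntegrand (fun x => π x - (‖x‖ ^ (-p) • radialExt A x
            + ‖x‖ ^ (-3 : ℝ) • radialExt B x)) i (r • (θ : E3)) := by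
  have hn : ‖r • (θ : E3)‖ = r := by
    rw [norm_smul, norm_eq_of_mem_sphere θ, mul_one, Real.norm_of_nonneg hr.le]
  have hrad : ∀ C : TensorField, radialExt C (r • (θ : E3)) = C θ := by
    intro C
    simp only [radialExt, hn, inv_smul_smul₀ hr.ne']
  have h1 : r ^ (1 - p) = r ^ (-p) * r := by
    rw [show 1 - p = -p + 1 by ring, Real.rpow_add_one hr.ne']
  have h2 : r ^ (-2 : ℝ) = r ^ (-3 : ℝ) * r := by
    rw [show (-2 : ℝ) = -3 + 1 by norm_num, Real.rpow_add_one hr.ne']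
  simp only [angularIntegrand, hn, hrad, rotationField_smul, norm_eq_of_mem_sphere θ,
    Finset.mul_sum, ← Finset.sum_add_distrib, h1, h2, Matrix.sub_apply, Matrix.add_apply,
    Matrix.smul_apply, smul_eq_mul, PiLp.smul_apply]
  refine Finset.sum_congr rfl fun j _ => Finset.sum_congr rfl fun k _ => ?_
  field_simp
  ring

/-- If the leading term carries no flux, the angular momentum is given by the `r^(-3)` term. -/
theorem HasMomentumExpansion.hasADMAngularMomentum {π A B : TensorField} {p : ℝ}
    (hA : IsC1OnSphere A) (hB : IsC1OnSphere B) (hπ : HasMomentumExpansion π A B p) (i : Fin 3)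
    (hzero : ∫ θ, angularIntegrand A i (θ : E3) ∂sphereArea = 0) :
    HasADMAngularMomentum π i
      (1 / (8 * Real.pi) * ∫ θ, angularIntegrand B i (θ : E3) ∂sphereArea) := by
  set E : TensorField := fun x => π x - (‖x‖ ^ (-p) • radialExt A x
    + ‖x‖ ^ (-3 : ℝ) • radialExt B x) with hEdef
  have hEe : ∀ j k, (fun x => E x j k) = fun x => π x j k
      - (radialExt A x j k * ‖x‖ ^ (-p) + radialExt B x j k * ‖x‖ ^ (-3 : ℝ)) := by
    intro j k
    funext x
    simp only [E, Matrix.sub_apply, Matrix.add_apply, Matrix.smul_apply, smul_eq_mul]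
    ring
  have hE : ∀ j k, IsLittleOOrder 1 (fun x => E x j k) (-3) := fun j k => by
    rw [hEe]
    exact hπ j k
  choose R hR using fun j k => (hE j k).1
  -- A single nonnegative radius dominating those of all nine components.
  set R₀ : ℝ := ∑ j, ∑ k, |R j k| with hR₀
  have hR₀0 : 0 ≤ R₀ := Finset.sum_nonneg fun j _ => Finset.sum_nonneg fun k _ => abs_nonneg _
  have hRle : ∀ j k, R j k ≤ R₀ := fun j k =>
    (le_abs_self _).trans ((Finset.single_le_sum (f := fun k => |R j k|)
      (fun k _ => abs_nonneg _) (Finset.mem_univ k)).trans (Finset.single_le_sum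
        (f := fun j => ∑ k, |R j k|) (fun j _ => Finset.sum_nonneg fun k _ => abs_nonneg _)
        (Finset.mem_univ j)))
  have hEc : ∀ j k, ContinuousOn (fun x => E x j k) {x | R₀ < ‖x‖} := fun j k =>
    (hR j k).continuousOn.mono fun x hx => lt_of_le_of_lt (hRle j k) hx
  have hEo : ∀ j k, (fun x => E x j k) =o[Bornology.cobounded E3] fun x => ‖x‖ ^ (-3 : ℝ) := by
    intro j k
    have h := ((hE j k).2 0 (Nat.zero_le 1)).norm_left
    simp only [norm_iteratedFDeriv_zero, Nat.cast_zero, sub_zero] at h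
    exact h.of_norm_left
  have hAi := integrable_angularIntegrand_sphere hA i
  have hBi := integrable_angularIntegrand_sphere hB i
  have hEi : ∀ r, R₀ < r → Integrable
      (fun θ : Metric.sphere (0 : E3) 1 => angularIntegrand E i (r • (θ : E3))) sphereArea :=
    fun r hr => integrable_angularIntegrand_smul hR₀0 hEc i hr
  have hsplit : ∀ r, 0 < r →
      (fun θ : Metric.sphere (0 : E3) 1 => angularIntegrand π i (r • (θ : E3)))
        = fun θ : Metric.sphere (0 : E3) 1 => r ^ (1 - p) * angularIntegrand A i θ
          + r ^ (-2 : ℝ) * angularIntegrand B i θ + angularIntegrand E i (r • (θ : E3)) :=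
    fun r hr => funext fun θ => angularIntegrand_smul_coe_sphere i hr θ
  refine ⟨?_, Tendsto.const_mul _ ?_⟩
  · filter_upwards [eventually_gt_atTop R₀] with r hr
    rw [hsplit r (hR₀0.trans_lt hr)]
    exact ((hAi.const_mul _).add (hBi.const_mul _)).add (hEi r hr)
  · have h1 := (tendsto_flux_zero_of_isLittleO (isLittleO_angularIntegrand hEo i)).const_add
      (∫ θ, angularIntegrand B i (θ : E3) ∂sphereArea)
    rw [add_zero] at h1
    refine h1.congr' ?_
    filter_upwards [eventually_gt_atTop R₀] with r hr
    have hr0 : 0 < r := hR₀0.trans_lt hr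
    have h5 : r ^ 2 * r ^ (-2 : ℝ) = 1 := by
      rw [Real.rpow_neg hr0.le, show (2 : ℝ) = ((2 : ℕ) : ℝ) by norm_num, Real.rpow_natCast]
      field_simp
    have h6 : Integrable (fun θ : Metric.sphere (0 : E3) 1 => r ^ (1 - p) * angularIntegrand A i θ
        + r ^ (-2 : ℝ) * angularIntegrand B i θ) sphereArea :=
      (hAi.const_mul _).add (hBi.const_mul _)
    rw [angularFlux, hsplit r hr0, integral_add h6 (hEi r hr), integral_add (hAi.const_mul _) (hBi.const_mul _),
      integral_const_mul, integral_const_mul, hzero, mul_zero, zero_add, mul_add, ← mul_assoc, h5,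
      one_mul]

theorem mainTheorem1 {M : Type*} [TopologicalSpace M] [T2Space M] [SecondCountableTopology M]
    [ChartedSpace E3 M] [IsManifold (𝓡 3) ∞ M]
    (D : InitialDataSet M) (S : D.AsymptoticallyFlat) (e : Fin S.numEnds)
    (p : ℝ) (hp : 3 / 2 < p) (hp' : p < 3)
    (A B : TensorField) (hA : IsC1OnSphere A) (hB : IsC1OnSphere B)
    (hπ : HasMomentumExpansion (D.momentumCoord (S.coord e)) A B p)
    (ε : ℝ) (hε : 0 < ε)
    (hJ : currentLength (D.gCoord (S.coord e)) (D.kCoord (S.coord e))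
      =O[Bornology.cobounded E3] fun x => ‖x‖ ^ (-4 - ε)) :
    ∀ i : Fin 3, ∃ L : ℝ,
      HasADMAngularMomentum (D.momentumCoord (S.coord e)) i L ∧
      L = 1 / (8 * Real.pi) * ∫ θ, angularIntegrand B i (θ : E3) ∂sphereArea ∧
      L = 1 / (8 * Real.pi) * ∫ θ, (θ : E3) i * starD (mixedPart B) (θ : E3) ∂sphereArea := by
  intro i
  -- Symmetry holds at every `x`, even off the target of the chart, since the components always
  -- evaluate a symmetric form on a pair of vectors.
  have hgsymm : ∀ x j k, D.gCoord (S.coord e) x j k = D.gCoord (S.coord e) x k j :=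
    fun x j k => D.g.symm _ _ _
  have hksymm : ∀ x j k, D.kCoord (S.coord e) x j k = D.kCoord (S.coord e) x k j :=
    fun x j k => D.k_symm _ _ _
  have hπsymm : ∀ x j k, D.momentumCoord (S.coord e) x j k
      = D.momentumCoord (S.coord e) x k j := fun x j k => by
    simp only [InitialDataSet.momentumCoord, conjugateMomentum, Matrix.sub_apply, Matrix.smul_apply,
      hgsymm x j k, hksymm x j k]
  have hzero : ∫ θ, angularIntegrand A i (θ : E3) ∂sphereArea = 0 :=
    integral_angularIntegrand_eq_zero hA hp'.ne
      (fun x hx j k => hπ.radialExt_symm hA hB hp' hπsymm hx j k)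
      (fun x hx j => HasMomentumExpansion.divergence_leading_eq_zero
        (by linarith [S.q_gt] : 0 < S.q)
        (fun i j => C1DecaysAt.of_isBigOOrder one_le_two (S.g_decay e i j)) hgsymm hksymm hA hB hp'
        hπ hJ (by linarith) hx j) i
  exact ⟨_, hπ.hasADMAngularMomentum hA hB i hzero, rfl,
    by rw [integral_coord_mul_starD_mixedPart hB i]⟩
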